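/- **Skew Boolean side.** A *skew lattice* is a set $S$ with two associative idempotent operations $\wedge,\vee$ satisfying $x\wedge(x\vee y)=x=x\vee(x\wedge y)$ and $(y\vee x)\wedge x=x=(y\wedge x)\vee x$. Its natural partial order is $x\le y \iff x\wedge y=y\wedge x=x$, and $x\,\mathcal D\,y$ means $x\wedge y\wedge x=x$ and $y\wedge x\wedge y=y$; the quotient $S/\mathcal D$ is the maximal lattice image of $S$. It is *left-handed* if $x\wedge y\wedge x=x\wedge y$ and $x\vee y\vee x=y\vee x$ for all $x,y$. A *skew Boolean algebra* $(S;\wedge,\vee,\setminus,0)$ is a skew lattice such that $x\vee y=y\vee x\iff x\wedge y=y\wedge x$, with an element $0$ satisfying $x\wedge 0=0\wedge x=0$, such that each $\lceil x\rceil=\{u: u\le x\}$ is a Boolean lattice under $\wedge,\vee$, and where $a\setminus b$ is the complement of $a\wedge b\wedge a$ in $\lceil a\rceil$. It is a *skew Boolean $\cap$-algebra* if every nonempty finite set of elements has a greatest lower bound for $\le$; then $a\cap b$ denotes the greatest lower bound of $a$ and $b$ and is added to the signature. A homomorphism $h:S\to T$ of skew Boolean $\cap$-algebras (a map preserving $\wedge,\vee,\setminus,\cap,0$)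 induces $\bar h:S/\mathcal D\to T/\mathcal D$, and is *proper* if for every $c\in T/\mathcal D$ there is $b\in S/\mathcal D$ with $\bar h(b)\ge c$. **Étale side.** A *Boolean space* is a compact Hausdorff space whose clopen sets form a base. An *étale space* $(E,\pi,X)$ over $X$ is a surjective local homeomorphism $\pi:E\to X$, with stalks $E_x=\pi^{-1}(x)$. A section over $U\subseteq X$ is a continuous map $s:U\to E$ with $\pi s=\mathrm{id}_U$, and $E(U)$ is the set of images of sections over $U$. If $X$ is a Boolean space, $(E,\pi,X)$ has *clopen equalizers* if for all clopen $U,V\subseteq X$ and all $A\in E(U)$, $B\in E(V)$ there is a clopen $W\subseteq X$ with $A\cap B\in E(W)$. An *étale space cohomomorphism* $(G,\rho,Y)\rightsquigarrow(E,\pi,X)$ consists of a continuous map $f:X\to Y$ and maps $k_x:G_{f(x)}\to E_x$ $(x\in X)$ such that for every open $U\subseteq Y$ and every section $s$ of $G$ over $U$, the map $x\mapsto k_x(s(f(x)))$ is a section of $E$ over $f^{-1}(U)$. It is *injective* if every $k_x$ is injective. The composite of $(f,k):(H,\sigma,Z)\rightsquigarrow (G,\rho,Y)$ and $(g,l):(G,\rho,Y)\rightsquigarrow(E,\pi,X)$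 is $(f\circ g,\,(l_x\circ k_{g(x)})_{x\in X})$. **Corollary.** The category whose objects are the étale spaces with clopen equalizers over Boolean spaces and whose morphisms are the injective étale space cohomomorphisms is equivalent to the category whose objects are the left-handed skew Boolean $\cap$-algebras $S$ such that $S/\mathcal D$ is a Boolean algebra and whose morphisms are the proper skew Boolean $\cap$-algebra homomorphisms. -/

import Mathlib

open CategoryTheory

universe u

namespace SkewStone

/-! ### Skew lattices -/

/-- A skew lattice: two associative idempotent operations that satisfy the absorption identities. -/
class SkewLattice (S : Type u) extends Min S, Max S where
  inf_assoc' : ∀ x y z : S, (x ⊓ y) ⊓ z = x ⊓ (y ⊓ z)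
  sup_assoc' : ∀ x y z : S, (x ⊔ y) ⊔ z = x ⊔ (y ⊔ z)
  inf_idem' : ∀ x : S, x ⊓ x = x
  sup_idem' : ∀ x : S, x ⊔ x = x
  inf_sup_absorb : ∀ x y : S, x ⊓ (x ⊔ y) = x
  sup_inf_absorb : ∀ x y : S, x ⊔ (x ⊓ y) = x
  sup_inf_absorb_right : ∀ x y : S, (y ⊔ x) ⊓ x = x
  inf_sup_absorb_right : ∀ x y : S, (y ⊓ x) ⊔ x = x

namespace SkewLattice

section Order

variable {S : Type u} [SkewLattice S]

/-- The natural partial order: `x ≤ y` if and only if `x ⊓ y = y ⊓ x = x`. -/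
instance instPartialOrder : PartialOrder S where
  le x y := x ⊓ y = x ∧ y ⊓ x = x
  le_refl x := ⟨inf_idem' x, inf_idem' x⟩
  le_trans x y z h₁ h₂ := by
    refine ⟨?_, ?_⟩
    · calc x ⊓ z = (x ⊓ y) ⊓ z := by rw [h₁.1]
        _ = x ⊓ (y ⊓ z) := inf_assoc' _ _ _
        _ = x := by rw [h₂.1, h₁.1]
    · calc z ⊓ x = z ⊓ (y ⊓ x) := by rw [h₁.2]
        _ = (z ⊓ y) ⊓ x := (inf_assoc' _ _ _).symm
        _ = x := by rw [h₂.2, h₁.2]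
  le_antisymm x y h₁ h₂ := h₁.1.symm.trans h₂.2

theorem le_iff_inf {x y : S} : x ≤ y ↔ x ⊓ y = x ∧ y ⊓ x = x := Iff.rfl

theorem inf_eq_left_iff_sup_eq {x y : S} : x ⊓ y = x ↔ x ⊔ y = y := by
  constructor
  · intro h
    have := inf_sup_absorb_right y x
    rwa [h] at this
  · intro h
    have := inf_sup_absorb x y
    rwa [h] at this

theorem inf_eq_right_iff_sup_eq {x y : S} : y ⊓ x = x ↔ y ⊔ x = y := by
  constructor
  · intro h
    have := sup_inf_absorb y x
    rwa [h] at this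
  · intro h
    have := sup_inf_absorb_right x y
    rwa [h] at this

theorem inf_le_of_le {a x y : S} (hx : x ≤ a) (hy : y ≤ a) : x ⊓ y ≤ a := by
  rw [le_iff_inf] at *
  exact ⟨by rw [inf_assoc', hy.1], by rw [← inf_assoc', hx.2]⟩

theorem sup_le_of_le {a x y : S} (hx : x ≤ a) (hy : y ≤ a) : x ⊔ y ≤ a := by
  rw [le_iff_inf, inf_eq_left_iff_sup_eq, inf_eq_right_iff_sup_eq] at *
  exact ⟨by rw [sup_assoc', hy.1, hx.1], by rw [← sup_assoc', hx.2, hy.2]⟩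

/-- The meet of the principal subalgebra `⌈a⌉ = {u | u ≤ a}`. -/
def principalInf (a : S) (u v : Set.Iic a) : Set.Iic a :=
  ⟨u.1 ⊓ v.1, inf_le_of_le u.2 v.2⟩

/-- The join of the principal subalgebra `⌈a⌉ = {u | u ≤ a}`. -/
def principalSup (a : S) (u v : Set.Iic a) : Set.Iic a :=
  ⟨u.1 ⊔ v.1, sup_le_of_le u.2 v.2⟩

/-- The relation `𝒟`. -/
def DRel (x y : S) : Prop := (x ⊓ y) ⊓ x = x ∧ (y ⊓ x) ⊓ y = y

end Order

/-- Left-handed skew lattices. -/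
class IsLeftHanded (S : Type u) [SkewLattice S] : Prop where
  inf_inf : ∀ x y : S, (x ⊓ y) ⊓ x = x ⊓ y
  sup_sup : ∀ x y : S, (x ⊔ y) ⊔ x = y ⊔ x

end SkewLattice

/-- The two operations are the meet and the join of a Boolean algebra. -/
def IsBooleanLattice {L : Type u} (meet join : L → L → L) : Prop :=
  ∃ b : BooleanAlgebra L, (∀ x y, b.inf x y = meet x y) ∧ (∀ x y, b.sup x y = join x y)

/-! ### The maximal lattice image of a left-handed skew lattice -/

section MaximalLatticeImage

open SkewLattice

variable (S : Type u) [SkewLattice S] [IsLeftHanded S]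

variable {S} in
/-- In a left-handed skew lattice the `𝒟`-classes are flat. -/
theorem dRel_iff {x y : S} : DRel x y ↔ x ⊓ y = x ∧ y ⊓ x = y := by
  unfold DRel
  rw [IsLeftHanded.inf_inf, IsLeftHanded.inf_inf]

variable {S} in
theorem dRel_iff_sup {x y : S} : DRel x y ↔ x ⊔ y = y ∧ y ⊔ x = x := by
  rw [dRel_iff, inf_eq_left_iff_sup_eq, inf_eq_left_iff_sup_eq]

variable {S} in
theorem DRel.inf_aux {x x' y y' : S} (hx : x ⊓ x' = x) (hy : y ⊓ y' = y) :
    (x ⊓ y) ⊓ (x' ⊓ y') = x ⊓ y := by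
  have h : (x ⊓ y) ⊓ x' = x ⊓ y := by
    calc (x ⊓ y) ⊓ x' = ((x ⊓ x') ⊓ y) ⊓ x' := by rw [hx]
      _ = x ⊓ ((x' ⊓ y) ⊓ x') := by simp only [inf_assoc']
      _ = x ⊓ (x' ⊓ y) := by rw [IsLeftHanded.inf_inf]
      _ = x ⊓ y := by rw [← inf_assoc', hx]
  rw [← inf_assoc', h, inf_assoc', hy]

variable {S} in
theorem DRel.sup_aux {x x' y y' : S} (hx : x ⊔ x' = x') (hy : y ⊔ y' = y') :
    (x ⊔ y) ⊔ (x' ⊔ y') = x' ⊔ y' := by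
  have h : y ⊔ (x' ⊔ y') = x' ⊔ y' := by
    calc y ⊔ (x' ⊔ y') = y ⊔ (x' ⊔ (y ⊔ y')) := by rw [hy]
      _ = ((y ⊔ x') ⊔ y) ⊔ y' := by simp only [sup_assoc']
      _ = (x' ⊔ y) ⊔ y' := by rw [IsLeftHanded.sup_sup]
      _ = x' ⊔ y' := by rw [sup_assoc', hy]
  rw [sup_assoc', h, ← sup_assoc', hx]

/-- The relation `𝒟` as a setoid. -/
def dSetoid : Setoid S where
  r := DRel
  iseqv := by
    refine ⟨fun x => dRel_iff.2 ⟨inf_idem' x, inf_idem' x⟩, ?_, ?_⟩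
    · intro x y h
      exact ⟨h.2, h.1⟩
    · intro x y z h₁ h₂
      rw [dRel_iff] at *
      exact ⟨by rw [← h₁.1, inf_assoc', h₂.1], by rw [← h₂.2, inf_assoc', h₁.2]⟩

/-- The quotient `S/𝒟`. -/
def DQuot : Type u := Quotient (dSetoid S)

variable {S}

/-- The canonical projection `S → S/𝒟`. -/
def DQuot.mk (x : S) : DQuot S := Quotient.mk (dSetoid S) x

theorem DQuot.sound {x y : S} (h : DRel x y) : DQuot.mk x = DQuot.mk y :=
  Quotient.sound (s := dSetoid S) h

theorem DQuot.exists_rep (a : DQuot S) : ∃ x : S, DQuot.mk x = a :=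
  Quotient.exists_rep a

/-- The meet of `S/𝒟`, induced by the one of `S`. -/
def DQuot.inf : DQuot S → DQuot S → DQuot S :=
  Quotient.map₂ (· ⊓ ·) (by
    intro x x' hx y y' hy
    have hx := dRel_iff.1 hx
    have hy := dRel_iff.1 hy
    exact dRel_iff.2 ⟨DRel.inf_aux hx.1 hy.1, DRel.inf_aux hx.2 hy.2⟩)

/-- The join of `S/𝒟`, induced by the one of `S`. -/
def DQuot.sup : DQuot S → DQuot S → DQuot S :=
  Quotient.map₂ (· ⊔ ·) (by
    intro x x' hx y y' hy
    have hx := dRel_iff_sup.1 hx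
    have hy := dRel_iff_sup.1 hy
    exact dRel_iff_sup.2 ⟨DRel.sup_aux hx.1 hy.1, DRel.sup_aux hx.2 hy.2⟩)

/-- The quotient `S/𝒟` is a lattice, the maximal lattice image of `S`. -/
instance : Lattice (DQuot S) :=
  letI : Min (DQuot S) := ⟨DQuot.inf⟩
  letI : Max (DQuot S) := ⟨DQuot.sup⟩
  have mk_inf (x y : S) : DQuot.mk x ⊓ DQuot.mk y = DQuot.mk (x ⊓ y) := rfl
  have mk_sup (x y : S) : DQuot.mk x ⊔ DQuot.mk y = DQuot.mk (x ⊔ y) := rfl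
  Lattice.mk'
    (by
      intro a b
      obtain ⟨x, rfl⟩ := a.exists_rep
      obtain ⟨y, rfl⟩ := b.exists_rep
      refine DQuot.sound (dRel_iff_sup.2 ?_)
      have key : ∀ u v : S, (u ⊔ v) ⊔ (v ⊔ u) = v ⊔ u := fun u v => by
        rw [sup_assoc', ← sup_assoc' v v u, sup_idem', ← sup_assoc', IsLeftHanded.sup_sup]
      exact ⟨key x y, key y x⟩)
    (by
      intro a b c
      obtain ⟨x, rfl⟩ := a.exists_rep
      obtain ⟨y, rfl⟩ := b.exists_rep
      obtain ⟨z, rfl⟩ := c.exists_rep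
      simp only [mk_sup, sup_assoc'])
    (by
      intro a b
      obtain ⟨x, rfl⟩ := a.exists_rep
      obtain ⟨y, rfl⟩ := b.exists_rep
      refine DQuot.sound (dRel_iff.2 ?_)
      have key : ∀ u v : S, (u ⊓ v) ⊓ (v ⊓ u) = u ⊓ v := fun u v => by
        rw [inf_assoc', ← inf_assoc' v v u, inf_idem', ← inf_assoc', IsLeftHanded.inf_inf]
      exact ⟨key x y, key y x⟩)
    (by
      intro a b c
      obtain ⟨x, rfl⟩ := a.exists_rep
      obtain ⟨y, rfl⟩ := b.exists_rep
      obtain ⟨z, rfl⟩ := c.exists_rep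
      simp only [mk_inf, inf_assoc'])
    (by
      intro a b
      obtain ⟨x, rfl⟩ := a.exists_rep
      obtain ⟨y, rfl⟩ := b.exists_rep
      simp only [mk_inf, mk_sup, sup_inf_absorb])
    (by
      intro a b
      obtain ⟨x, rfl⟩ := a.exists_rep
      obtain ⟨y, rfl⟩ := b.exists_rep
      simp only [mk_inf, mk_sup, inf_sup_absorb])

theorem DQuot.mk_inf (x y : S) : DQuot.mk (x ⊓ y) = DQuot.mk x ⊓ DQuot.mk y := rfl

theorem DQuot.mk_sup (x y : S) : DQuot.mk (x ⊔ y) = DQuot.mk x ⊔ DQuot.mk y := rfl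

end MaximalLatticeImage

/-! ### Skew Boolean algebras -/

/-- A skew Boolean algebra `(S; ⊓, ⊔, \, 0)`: a symmetric skew lattice with zero whose principal
subalgebras are Boolean lattices. The element `a \ b` is the complement of `a ⊓ b ⊓ a` in the
Boolean lattice `⌈a⌉`, whose least element is `0` and whose greatest element is `a`. -/
class SkewBooleanAlgebra (S : Type u) extends SkewLattice S, Zero S, SDiff S where
  symmetric : ∀ x y : S, x ⊔ y = y ⊔ x ↔ x ⊓ y = y ⊓ x
  inf_zero : ∀ x : S, x ⊓ 0 = 0
  zero_inf : ∀ x : S, 0 ⊓ x = 0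
  boolean : ∀ x : S,
    IsBooleanLattice (SkewLattice.principalInf x) (SkewLattice.principalSup x)
  sdiff_le' : ∀ a b : S, a \ b ≤ a
  inf_sdiff' : ∀ a b : S, ((a ⊓ b) ⊓ a) ⊓ (a \ b) = 0
  sup_sdiff' : ∀ a b : S, ((a ⊓ b) ⊓ a) ⊔ (a \ b) = a

/-- A skew Boolean `∩`-algebra `(S; ⊓, ⊔, \, ∩, 0)`: all finite nonempty sets of elements have
a greatest lower bound for the natural partial order, and `cap a b` is the one of `a` and `b`. -/
class SkewBooleanCapAlgebra (S : Type u) extends SkewBooleanAlgebra S where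
  cap : S → S → S
  exists_isGLB : ∀ t : Set S, t.Finite → t.Nonempty → ∃ m : S, IsGLB t m
  cap_isGLB : ∀ a b : S, IsGLB {a, b} (cap a b)

/-- Objects: left-handed skew Boolean `∩`-algebras whose maximal lattice image is
a Boolean algebra. -/
structure BLSBIA : Type (u + 1) where
  carrier : Type u
  [alg : SkewBooleanCapAlgebra carrier]
  [leftHanded : SkewLattice.IsLeftHanded carrier]
  boolean : IsBooleanLattice (fun a b : DQuot carrier => a ⊓ b) (fun a b => a ⊔ b)

attribute [instance] BLSBIA.alg BLSBIA.leftHanded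

/-- Homomorphisms of skew Boolean `∩`-algebras. -/
structure CapHom (S T : Type u) [SkewBooleanCapAlgebra S] [SkewBooleanCapAlgebra T] where
  toFun : S → T
  map_inf : ∀ x y, toFun (x ⊓ y) = toFun x ⊓ toFun y
  map_sup : ∀ x y, toFun (x ⊔ y) = toFun x ⊔ toFun y
  map_sdiff : ∀ x y, toFun (x \ y) = toFun x \ toFun y
  map_zero : toFun 0 = 0
  map_cap : ∀ x y, toFun (SkewBooleanCapAlgebra.cap x y) =
    SkewBooleanCapAlgebra.cap (toFun x) (toFun y)

namespace CapHom

variable {S T R : Type u} [SkewBooleanCapAlgebra S] [SkewBooleanCapAlgebra T]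
  [SkewBooleanCapAlgebra R]

@[ext]
theorem ext {f g : CapHom S T} (h : ∀ x, f.toFun x = g.toFun x) : f = g := by
  cases f
  cases g
  congr
  exact funext h

/-- The identity homomorphism. -/
def id (S : Type u) [SkewBooleanCapAlgebra S] : CapHom S S where
  toFun x := x
  map_inf _ _ := rfl
  map_sup _ _ := rfl
  map_sdiff _ _ := rfl
  map_zero := rfl
  map_cap _ _ := rfl

/-- The composite `g ∘ f`. -/
def comp (g : CapHom T R) (f : CapHom S T) : CapHom S R where
  toFun x := g.toFun (f.toFun x)
  map_inf x y := by rw [f.map_inf, g.map_inf]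
  map_sup x y := by rw [f.map_sup, g.map_sup]
  map_sdiff x y := by rw [f.map_sdiff, g.map_sdiff]
  map_zero := by rw [f.map_zero, g.map_zero]
  map_cap x y := by rw [f.map_cap, g.map_cap]

variable [SkewLattice.IsLeftHanded S] [SkewLattice.IsLeftHanded T]
  [SkewLattice.IsLeftHanded R]

/-- The map `S/𝒟 → T/𝒟` induced by a homomorphism `S → T`. -/
def induced (f : CapHom S T) : DQuot S → DQuot T :=
  Quotient.map f.toFun (by
    intro x y h
    refine ⟨?_, ?_⟩
    · rw [← f.map_inf, ← f.map_inf, h.1]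
    · rw [← f.map_inf, ← f.map_inf, h.2])

theorem induced_mk (f : CapHom S T) (x : S) :
    f.induced (DQuot.mk x) = DQuot.mk (f.toFun x) := rfl

theorem induced_mono (f : CapHom S T) : Monotone f.induced := by
  intro a b h
  obtain ⟨x, rfl⟩ := a.exists_rep
  obtain ⟨y, rfl⟩ := b.exists_rep
  rw [← inf_eq_left] at h ⊢
  rw [induced_mk, induced_mk, ← DQuot.mk_inf, ← f.map_inf, ← induced_mk, DQuot.mk_inf, h,
    induced_mk]

/-- A homomorphism is proper if the induced homomorphism of maximal lattice images is. -/
def IsProper (f : CapHom S T) : Prop := ∀ c : DQuot T, ∃ b : DQuot S, c ≤ f.induced b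

theorem isProper_id : (CapHom.id S).IsProper := by
  intro c
  obtain ⟨x, rfl⟩ := c.exists_rep
  exact ⟨DQuot.mk x, le_rfl⟩

theorem IsProper.comp {g : CapHom T R} {f : CapHom S T} (hg : g.IsProper) (hf : f.IsProper) :
    (g.comp f).IsProper := by
  intro c
  obtain ⟨b, hb⟩ := hg c
  obtain ⟨a, ha⟩ := hf b
  refine ⟨a, hb.trans ((g.induced_mono ha).trans ?_)⟩
  obtain ⟨x, rfl⟩ := a.exists_rep
  exact le_rfl

end CapHom

/-- The category whose morphisms are the proper skew Boolean `∩`-algebra homomorphisms. -/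
instance : Category.{u} BLSBIA.{u} where
  Hom S T := { f : CapHom S.carrier T.carrier // f.IsProper }
  id S := ⟨CapHom.id S.carrier, CapHom.isProper_id⟩
  comp f g := ⟨g.1.comp f.1, g.2.comp f.2⟩

/-! ### Étale spaces -/

/-- Boolean spaces: compact Hausdorff spaces in which the clopen sets form a base. -/
class BooleanSpace (X : Type u) [TopologicalSpace X] : Prop extends CompactSpace X, T2Space X where
  isTopologicalBasis_clopen : TopologicalSpace.IsTopologicalBasis {U : Set X | IsClopen U}

/-- The map `s : U → E` is a section of `π : E → X` over `U`. -/
def IsSection {E X : Type u} [TopologicalSpace E] [TopologicalSpace X] (π : E → X) (U : Set X)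
    (s : U → E) : Prop :=
  Continuous s ∧ ∀ x : U, π (s x) = x

/-- The set `E(U)` of sections over `U`, where sections are regarded as subsets of `E`. -/
def sectionSets {E X : Type u} [TopologicalSpace E] [TopologicalSpace X] (π : E → X) (U : Set X) :
    Set (Set E) :=
  {A | ∃ s : U → E, IsSection π U s ∧ A = Set.range s}

/-- Objects: étale spaces with clopen equalizers over Boolean spaces. -/
structure ESBSE : Type (u + 1) where
  base : Type u
  total : Type u
  [topBase : TopologicalSpace base]
  [topTotal : TopologicalSpace total]
  [booleanSpace : BooleanSpace base]
  proj : total → base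
  isLocalHomeomorph : IsLocalHomeomorph proj
  surjective : Function.Surjective proj
  clopen_equalizers : ∀ U V : Set base, IsClopen U → IsClopen V →
    ∀ A ∈ sectionSets proj U, ∀ B ∈ sectionSets proj V,
      ∃ W : Set base, IsClopen W ∧ A ∩ B ∈ sectionSets proj W

attribute [instance] ESBSE.topBase ESBSE.topTotal ESBSE.booleanSpace

namespace ESBSE

/-- The stalk at `x`. -/
def Stalk (A : ESBSE.{u}) (x : A.base) : Type u := { a : A.total // A.proj a = x }

/-- The function `x ↦ k_x (s (f x))` on `f ⁻¹ U`, where `s` is a section over `U` and `k` is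
a family of maps `k_x` from the stalk at `f x` to the stalk at `x`. -/
def pushSection {A B : ESBSE.{u}} (f : A.base → B.base)
    (k : ∀ x : A.base, B.Stalk (f x) → A.Stalk x) (U : Set B.base) (s : U → B.total)
    (hs : IsSection B.proj U s) : f ⁻¹' U → A.total :=
  fun x => (k x.1 ⟨s ⟨f x.1, x.2⟩, hs.2 _⟩).1

/-- An injective étale space cohomomorphism `B ⇝ A` over a continuous map `f` from the base
of `A` to the base of `B`. -/
@[ext]
structure Cohom (B A : ESBSE.{u}) where
  f : C(A.base, B.base)
  k : ∀ x : A.base, B.Stalk (f x) → A.Stalk x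
  isSection : ∀ (U : Set B.base), IsOpen U → ∀ (s : U → B.total) (hs : IsSection B.proj U s),
    IsSection A.proj (f ⁻¹' U) (pushSection f k U s hs)
  injective : ∀ x, Function.Injective (k x)

/-- The identity cohomomorphism. -/
def Cohom.id (A : ESBSE.{u}) : Cohom A A where
  f := ContinuousMap.id _
  k _ a := a
  isSection _ _ _ hs := hs
  injective _ _ _ h := h

/-- The composite of `k : C ⇝ B` and `l : B ⇝ A`. -/
def Cohom.comp {C B A : ESBSE.{u}} (k : Cohom C B) (l : Cohom B A) : Cohom C A where
  f := k.f.comp l.f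
  k x c := l.k x (k.k (l.f x) c)
  isSection U hU s hs :=
    l.isSection (k.f ⁻¹' U) (hU.preimage k.f.continuous) _ (k.isSection U hU s hs)
  injective x := (l.injective x).comp (k.injective (l.f x))

/-- The category whose morphisms from `B` to `A` are the injective étale space
cohomomorphisms `B ⇝ A`. -/
instance : Category.{u} ESBSE.{u} where
  Hom B A := Cohom B A
  id := Cohom.id
  comp := Cohom.comp

end ESBSE

end SkewStone

namespace SkewStone

/-! ### Order-theoretic preliminaries -/

/-! This is Stone duality with sections in place of clopen sets. The sections of an étale space over
clopen sets form an algebra: `s ⊓ t` restricts `s` to the domain of `t`, `s ⊔ t` extends `t` by `s`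
off the domain of `t`, the natural order is inclusion, and `∩` is intersection, which stays in the
algebra by clopen equalizers. Two sections are `𝒟`-related when their domains agree, so `S/𝒟` is the
clopen algebra of the base. A cohomomorphism pushes sections forward, which gives `sectionFunctor`;
injectivity on stalks makes intersections survive.

The functor is faithful because clopen sets separate points of the base and sections pass through
every point of a stalk. For fullness, a proper `h` and a point `x` give the filter of domains of
those `s` with `x` in the domain of `h s`; compactness yields a point `f x` in all of them
(`exists_base_point`), and preservation of `∩` makes the stalk map well defined
(`exists_stalk_point`).

For essential surjectivity the base is the closed set of characters in `S → Bool`, and the points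
above a character `φ` are germs: `a` and `b` agree at `φ` when `φ` is true at `cap a b`. Sending `a`
to its set of germs is injective by the prime ideal theorem (`eq_of_forall_character`) and
surjective by compactness (`surjective_germHom`). -/

theorem isBooleanLattice_of_injective {L : Type u} {α : Type*} [BooleanAlgebra α] [Nonempty L]
    {meet join : L → L → L} (f : L → α) (hf : Function.Injective f)
    (hmeet : ∀ x y, f (meet x y) = f x ⊓ f y) (hjoin : ∀ x y, f (join x y) = f x ⊔ f y)
    (hcompl : ∀ x, ∃ y, f y = (f x)ᶜ) : IsBooleanLattice meet join := by
  classical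
  choose c hc using hcompl
  let x₀ : L := Classical.arbitrary L
  let _ : LE L := ⟨fun x y => f x ≤ f y⟩
  let _ : LT L := ⟨fun x y => f x < f y⟩
  let _ : Min L := ⟨meet⟩
  let _ : Max L := ⟨join⟩
  -- No bounds are given: any element joined or met with its complement supplies them.
  let _ : Top L := ⟨join x₀ (c x₀)⟩
  let _ : Bot L := ⟨meet x₀ (c x₀)⟩
  let _ : Compl L := ⟨c⟩
  let _ : SDiff L := ⟨fun x y => meet x (c y)⟩
  let _ : HImp L := ⟨fun x y => join y (c x)⟩
  refine ⟨hf.booleanAlgebra f Iff.rfl Iff.rfl hjoin hmeet ?_ ?_ hc ?_ ?_,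
    fun _ _ => rfl, fun _ _ => rfl⟩
  · exact (hjoin _ _).trans (by rw [hc, sup_compl_eq_top])
  · exact (hmeet _ _).trans (by rw [hc, inf_compl_eq_bot])
  · exact fun x y => (hmeet _ _).trans (by rw [hc, sdiff_eq])
  · exact fun x y => (hjoin _ _).trans (by rw [hc, himp_eq])

theorem exists_isGLB_of_finite {α : Type*} [PartialOrder α] (cap : α → α → α)
    (hcap : ∀ a b, IsGLB {a, b} (cap a b)) (t : Set α) (ht : t.Finite) (hne : t.Nonempty) :
    ∃ m, IsGLB t m := by
  induction t, ht using Set.Finite.induction_on with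
  | empty => exact absurd hne Set.not_nonempty_empty
  | @insert a s _ _ ih =>
    rcases s.eq_empty_or_nonempty with rfl | hs
    · exact ⟨a, by simp⟩
    · obtain ⟨m, hm⟩ := ih hs
      refine ⟨cap a m, ?_, ?_⟩
      · rintro x (rfl | hx)
        · exact (hcap x m).1 (by simp)
        · exact ((hcap a m).1 (by simp)).trans (hm.1 hx)
      · intro x hx
        refine (hcap a m).2 ?_
        rintro y (rfl | rfl)
        · exact hx (by simp)
        · exact hm.2 fun z hz => hx (by simp [hz])

/-! ### Sections of local homeomorphisms -/

section LocalHomeo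

variable {E X : Type u} [TopologicalSpace E] [TopologicalSpace X] {π : E → X}

/-- `π ∘ s` is the inclusion of an open set, hence a local homeomorphism; cancelling `π` makes `s`
one too, hence open. -/
theorem isOpen_range_section (hπ : IsLocalHomeomorph π) {U : Set X} (hU : IsOpen U) {s : U → E}
    (hs : IsSection π U s) : IsOpen (Set.range s) := by
  have hc : π ∘ s = (Subtype.val : U → X) := funext hs.2
  have hl : IsLocalHomeomorph (π ∘ s) := hc ▸ hU.isOpenEmbedding_subtypeVal.isLocalHomeomorph
  exact (IsLocalHomeomorph.of_comp hl hπ hs.1).isOpenMap.isOpen_range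

theorem injOn_range_section {U : Set X} {s : U → E} (hs : IsSection π U s) :
    Set.InjOn π (Set.range s) := by
  rintro _ ⟨x, rfl⟩ _ ⟨y, rfl⟩ h
  rw [hs.2, hs.2] at h
  rw [Subtype.ext h]

theorem image_range_section {U : Set X} {s : U → E} (hs : IsSection π U s) :
    π '' Set.range s = U := by
  ext x
  constructor
  · rintro ⟨_, ⟨y, rfl⟩, rfl⟩
    rw [hs.2]
    exact y.2
  · exact fun hx => ⟨s ⟨x, hx⟩, ⟨_, rfl⟩, hs.2 _⟩

/-- The inverse of `π` on `A` is continuous because `π` is open: the preimage of `O` is `π '' (O ∩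
A)`. -/
theorem exists_section_of_injOn (hπ : IsLocalHomeomorph π) {A : Set E} (hA : IsOpen A)
    (hi : Set.InjOn π A) : ∃ s : (π '' A : Set X) → E, IsSection π (π '' A) s ∧
      A = Set.range s := by
  choose s hsA hs using fun x : (π '' A : Set X) => x.2
  refine ⟨s, ⟨continuous_def.2 fun O hO => ?_, hs⟩, ?_⟩
  · have h : s ⁻¹' O = Subtype.val ⁻¹' (π '' (O ∩ A)) := by
      ext x
      constructor
      · exact fun hx => ⟨s x, ⟨hx, hsA x⟩, hs x⟩
      · rintro ⟨e, ⟨heO, heA⟩, he⟩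
        have : s x = e := hi (hsA x) heA ((hs x).trans he.symm)
        rwa [Set.mem_preimage, this]
    rw [h]
    exact (hπ.isOpenMap _ (hO.inter hA)).preimage continuous_subtype_val
  · ext e
    constructor
    · exact fun he => ⟨⟨π e, e, he, rfl⟩, hi (hsA _) he (hs _)⟩
    · rintro ⟨x, rfl⟩
      exact hsA x

theorem mem_sectionSets_iff (hπ : IsLocalHomeomorph π) {U : Set X} (hU : IsOpen U) {A : Set E} :
    A ∈ sectionSets π U ↔ IsOpen A ∧ Set.InjOn π A ∧ π '' A = U := by
  constructor
  · rintro ⟨s, hs, rfl⟩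
    exact ⟨isOpen_range_section hπ hU hs, injOn_range_section hs, image_range_section hs⟩
  · rintro ⟨hA, hi, rfl⟩
    exact exists_section_of_injOn hπ hA hi

end LocalHomeo

/-! ### The algebra of sections over clopen sets -/

/-- A section over a clopen set, regarded as a subset of the total space. -/
@[ext]
structure ClopenSection (A : ESBSE.{u}) : Type u where
  carrier : Set A.total
  isOpen : IsOpen carrier
  injOn : Set.InjOn A.proj carrier
  isClopen_dom : IsClopen (A.proj '' carrier)

namespace ClopenSection

variable {A : ESBSE.{u}}

/-- The domain of a section. -/
def dom (s : ClopenSection A) : Set A.base := A.proj '' s.carrier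

theorem proj_mem_dom {s : ClopenSection A} {e : A.total} (h : e ∈ s.carrier) :
    A.proj e ∈ s.dom := ⟨e, h, rfl⟩

theorem ext_mem {s t : ClopenSection A} (h : ∀ e, e ∈ s.carrier ↔ e ∈ t.carrier) : s = t :=
  ClopenSection.ext (Set.ext h)

theorem isOpen_restrict (s : ClopenSection A) {V : Set A.base} (hV : IsOpen V) :
    IsOpen (s.carrier ∩ A.proj ⁻¹' V) :=
  s.isOpen.inter (hV.preimage A.isLocalHomeomorph.continuous)

theorem image_restrict (s : ClopenSection A) (V : Set A.base) :
    A.proj '' (s.carrier ∩ A.proj ⁻¹' V) = s.dom ∩ V :=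
  Set.image_inter_preimage _ _ _

/-- The restriction of a section to a clopen set. -/
def restrict (s : ClopenSection A) (V : Set A.base) (hV : IsClopen V) : ClopenSection A where
  carrier := s.carrier ∩ A.proj ⁻¹' V
  isOpen := s.isOpen_restrict hV.isOpen
  injOn := s.injOn.mono Set.inter_subset_left
  isClopen_dom := by
    rw [image_restrict]
    exact s.isClopen_dom.inter hV

instance : Zero (ClopenSection A) :=
  ⟨⟨∅, isOpen_empty, Set.injOn_empty _, by rw [Set.image_empty]; exact isClopen_empty⟩⟩

instance : Min (ClopenSection A) := ⟨fun s t => s.restrict t.dom t.isClopen_dom⟩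

instance : SDiff (ClopenSection A) := ⟨fun s t => s.restrict t.domᶜ t.isClopen_dom.compl⟩

/-- The right argument prevails where both are defined, as the left-handed law `x ⊔ y ⊔ x = y ⊔ x`
demands. -/
instance : Max (ClopenSection A) where
  max s t :=
    { carrier := t.carrier ∪ (s.carrier ∩ A.proj ⁻¹' t.domᶜ)
      isOpen := t.isOpen.union (s.isOpen_restrict t.isClopen_dom.compl.isOpen)
      injOn := by
        rintro e (he | ⟨he, he'⟩) e' (hf | ⟨hf, hf'⟩) h
        · exact t.injOn he hf h
        · exact absurd (h ▸ proj_mem_dom he) hf'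
        · exact absurd (h ▸ proj_mem_dom hf) he'
        · exact s.injOn he hf h
      isClopen_dom := by
        rw [Set.image_union, image_restrict]
        exact t.isClopen_dom.union (s.isClopen_dom.inter t.isClopen_dom.compl) }

/-- This is where clopen equalizers are needed: they make intersection an operation of the algebra.
-/
theorem isClopen_image_inter (s t : ClopenSection A) :
    IsClopen (A.proj '' (s.carrier ∩ t.carrier)) := by
  obtain ⟨W, hW, h⟩ := A.clopen_equalizers s.dom t.dom s.isClopen_dom t.isClopen_dom
    s.carrier ((mem_sectionSets_iff A.isLocalHomeomorph s.isClopen_dom.isOpen).2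
      ⟨s.isOpen, s.injOn, rfl⟩)
    t.carrier ((mem_sectionSets_iff A.isLocalHomeomorph t.isClopen_dom.isOpen).2
      ⟨t.isOpen, t.injOn, rfl⟩)
  rwa [((mem_sectionSets_iff A.isLocalHomeomorph hW.isOpen).1 h).2.2]

/-- The intersection of two sections. -/
def inter (s t : ClopenSection A) : ClopenSection A where
  carrier := s.carrier ∩ t.carrier
  isOpen := s.isOpen.inter t.isOpen
  injOn := s.injOn.mono Set.inter_subset_left
  isClopen_dom := isClopen_image_inter s t

theorem notMem_zero (e : A.total) : e ∉ (0 : ClopenSection A).carrier := id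

theorem mem_inf {s t : ClopenSection A} {e : A.total} :
    e ∈ (s ⊓ t).carrier ↔ e ∈ s.carrier ∧ A.proj e ∈ t.dom := Iff.rfl

theorem mem_sdiff {s t : ClopenSection A} {e : A.total} :
    e ∈ (s \ t).carrier ↔ e ∈ s.carrier ∧ A.proj e ∉ t.dom := Iff.rfl

theorem mem_sup {s t : ClopenSection A} {e : A.total} :
    e ∈ (s ⊔ t).carrier ↔ e ∈ t.carrier ∨ e ∈ s.carrier ∧ A.proj e ∉ t.dom := Iff.rfl

theorem mem_inter {s t : ClopenSection A} {e : A.total} :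
    e ∈ (s.inter t).carrier ↔ e ∈ s.carrier ∧ e ∈ t.carrier := Iff.rfl

theorem dom_restrict (s : ClopenSection A) (V : Set A.base) (hV : IsClopen V) :
    (s.restrict V hV).dom = s.dom ∩ V := s.image_restrict V

theorem dom_zero : (0 : ClopenSection A).dom = ∅ := Set.image_empty _

theorem dom_inf (s t : ClopenSection A) : (s ⊓ t).dom = s.dom ∩ t.dom := s.image_restrict _

theorem dom_sdiff (s t : ClopenSection A) : (s \ t).dom = s.dom \ t.dom := s.image_restrict _

theorem dom_sup (s t : ClopenSection A) : (s ⊔ t).dom = s.dom ∪ t.dom := by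
  refine (Set.image_union _ _ _).trans ?_
  rw [image_restrict, ← Set.sdiff_eq, Set.union_comm]
  exact Set.sdiff_union_self

/-- Read pointwise, every identity is a propositional tautology in membership and domain, given that
points of a section project into its domain. -/
instance : SkewLattice (ClopenSection A) where
  inf_assoc' x y z := ext_mem fun e => by
    simp only [mem_inf, dom_inf, Set.mem_inter_iff, and_assoc]
  sup_assoc' x y z := ext_mem fun e => by
    simp only [mem_sup, dom_sup, Set.mem_union]
    tauto
  inf_idem' x := ext_mem fun e => by
    have := @proj_mem_dom A x e
    simp only [mem_inf]
    tauto
  sup_idem' x := ext_mem fun e => by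
    have := @proj_mem_dom A x e
    simp only [mem_sup]
    tauto
  inf_sup_absorb x y := ext_mem fun e => by
    have := @proj_mem_dom A x e
    simp only [mem_inf, dom_sup, Set.mem_union]
    tauto
  sup_inf_absorb x y := ext_mem fun e => by
    have := @proj_mem_dom A x e
    simp only [mem_inf, mem_sup, dom_inf, Set.mem_inter_iff]
    tauto
  sup_inf_absorb_right x y := ext_mem fun e => by
    have := @proj_mem_dom A x e
    simp only [mem_inf, mem_sup]
    tauto
  inf_sup_absorb_right x y := ext_mem fun e => by
    have := @proj_mem_dom A x e
    simp only [mem_inf, mem_sup]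
    tauto

instance : SkewLattice.IsLeftHanded (ClopenSection A) where
  inf_inf x y := ext_mem fun e => by
    have := @proj_mem_dom A x e
    simp only [mem_inf]
    tauto
  sup_sup x y := ext_mem fun e => by
    simp only [mem_sup]
    tauto

theorem le_iff {s t : ClopenSection A} : s ≤ t ↔ s.carrier ⊆ t.carrier := by
  constructor
  · intro h e he
    have : e ∈ (t ⊓ s).carrier := by rwa [h.2]
    exact this.1
  · intro h
    refine ⟨ext_mem fun e => ⟨fun he => he.1, fun he => ⟨he, proj_mem_dom (h he)⟩⟩,
      ext_mem fun e => ⟨?_, fun he => ⟨h he, proj_mem_dom he⟩⟩⟩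
    rintro ⟨he, e', he', hp⟩
    rwa [← t.injOn (h he') he hp]

theorem isBooleanLattice_principal (x : ClopenSection A) :
    IsBooleanLattice (SkewLattice.principalInf x) (SkewLattice.principalSup x) := by
  have : Nonempty (Set.Iic x) := ⟨⟨x, le_refl x⟩⟩
  -- Two sections below `x` agree wherever both are defined, so `⊓` and `⊔` below `x` are
  -- intersection and union of subsets of `x`.
  have key {u v : Set.Iic x} {e e' : A.total} (h : e ∈ u.1.carrier) (h' : e' ∈ v.1.carrier)
      (hp : A.proj e' = A.proj e) : e' = e := x.injOn (le_iff.1 v.2 h') (le_iff.1 u.2 h) hp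
  refine isBooleanLattice_of_injective
    (fun u : Set.Iic x => {e : x.carrier | e.1 ∈ u.1.carrier}) ?_ ?_ ?_ ?_
  · intro u v h
    refine Subtype.ext (ext_mem fun e => ⟨fun he => ?_, fun he => ?_⟩)
    · exact (Set.ext_iff.1 h ⟨e, le_iff.1 u.2 he⟩).1 he
    · exact (Set.ext_iff.1 h ⟨e, le_iff.1 v.2 he⟩).2 he
  · intro u v
    ext e
    constructor
    · rintro ⟨he, e', he', hp⟩
      exact ⟨he, show e.1 ∈ v.1.carrier from key he he' hp ▸ he'⟩
    · exact fun he => ⟨he.1, proj_mem_dom he.2⟩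
  · intro u v
    ext e
    constructor
    · rintro (he | ⟨he, -⟩)
      exacts [Or.inr he, Or.inl he]
    · rintro (he | he)
      · by_cases h : A.proj e.1 ∈ v.1.dom
        · obtain ⟨e', he', hp⟩ := h
          exact Or.inl (show e.1 ∈ v.1.carrier from key he he' hp ▸ he')
        · exact Or.inr ⟨he, h⟩
      · exact Or.inl he
  · intro u
    refine ⟨⟨x \ u.1, le_iff.2 fun e he => he.1⟩, ?_⟩
    ext e
    constructor
    · exact fun he he' => he.2 (proj_mem_dom he')
    · refine fun he => ⟨e.2, ?_⟩
      rintro ⟨e', he', hp⟩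
      exact he (show e.1 ∈ u.1.carrier from x.injOn (le_iff.1 u.2 he') e.2 hp ▸ he')

instance : SkewBooleanAlgebra (ClopenSection A) where
  symmetric x y := by
    simp only [ClopenSection.ext_iff, Set.ext_iff, mem_sup, mem_inf]
    refine forall_congr' fun e => ?_
    have := @proj_mem_dom A x e
    have := @proj_mem_dom A y e
    tauto
  inf_zero x := ext_mem fun e => by simp [mem_inf, dom_zero, notMem_zero]
  zero_inf x := ext_mem fun e => by simp [mem_inf, notMem_zero]
  boolean := isBooleanLattice_principal
  sdiff_le' x y := le_iff.2 fun e he => he.1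
  inf_sdiff' x y := ext_mem fun e => by
    simp only [mem_inf, dom_sdiff, notMem_zero, Set.mem_sdiff]
    tauto
  sup_sdiff' x y := ext_mem fun e => by
    have := @proj_mem_dom A x e
    simp only [mem_sup, mem_inf, mem_sdiff, dom_sdiff, Set.mem_sdiff]
    tauto

theorem isGLB_inter (s t : ClopenSection A) : IsGLB {s, t} (s.inter t) := by
  refine ⟨?_, fun m hm => ?_⟩
  · rintro x (rfl | rfl)
    · exact le_iff.2 Set.inter_subset_left
    · exact le_iff.2 Set.inter_subset_right
  · exact le_iff.2 (Set.subset_inter (le_iff.1 (hm (by simp))) (le_iff.1 (hm (by simp))))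

instance : SkewBooleanCapAlgebra (ClopenSection A) where
  cap := inter
  exists_isGLB := exists_isGLB_of_finite _ isGLB_inter
  cap_isGLB := isGLB_inter

theorem mem_cap {s t : ClopenSection A} {e : A.total} :
    e ∈ (SkewBooleanCapAlgebra.cap s t).carrier ↔ e ∈ s.carrier ∧ e ∈ t.carrier := Iff.rfl

/-- The domain of injectivity of a local homeomorphism is cut down to lie over a clopen
neighbourhood. -/
theorem exists_mem_carrier (e : A.total) : ∃ s : ClopenSection A, e ∈ s.carrier := by
  obtain ⟨h, he, hh⟩ := A.isLocalHomeomorph e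
  have ho : IsOpen (A.proj '' h.source) := A.isLocalHomeomorph.isOpenMap _ h.open_source
  obtain ⟨V, hV, heV, hVs⟩ := BooleanSpace.isTopologicalBasis_clopen.exists_subset_of_mem_open
    (Set.mem_image_of_mem A.proj he) ho
  refine ⟨⟨h.source ∩ A.proj ⁻¹' V,
    h.open_source.inter (hV.isOpen.preimage A.isLocalHomeomorph.continuous), ?_, ?_⟩, he, heV⟩
  · intro a ha b hb hab
    rw [hh] at hab
    exact h.injOn ha.1 hb.1 hab
  · rw [Set.image_inter_preimage, Set.inter_eq_right.2 hVs]
    exact hV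

/-- Étale spaces over Boolean spaces have global sections. -/
theorem exists_dom_eq_univ (A : ESBSE.{u}) : ∃ s : ClopenSection A, s.dom = Set.univ := by
  obtain ⟨t, ht⟩ := isCompact_univ.elim_finite_subcover
    (fun s : ClopenSection A => s.dom) (fun s => s.isClopen_dom.isOpen) fun x _ => by
      obtain ⟨e, rfl⟩ := A.surjective x
      obtain ⟨s, hs⟩ := exists_mem_carrier e
      exact Set.mem_iUnion.2 ⟨s, proj_mem_dom hs⟩
  classical
  -- Since `⊔` overrides instead of gluing, finitely many sections combine without agreeing on
  -- overlaps.
  have key : ∀ t : Finset (ClopenSection A), ∃ s : ClopenSection A, ∀ r ∈ t, r.dom ⊆ s.dom := by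
    intro t
    induction t using Finset.induction_on with
    | empty => exact ⟨0, by simp⟩
    | insert a t _ ih =>
      obtain ⟨s, hs⟩ := ih
      refine ⟨a ⊔ s, fun r hr => ?_⟩
      rw [dom_sup]
      rcases Finset.mem_insert.1 hr with rfl | hr
      · exact Set.subset_union_left
      · exact (hs r hr).trans Set.subset_union_right
  obtain ⟨s, hs⟩ := key t
  exact ⟨s, Set.univ_subset_iff.1 (ht.trans (Set.iUnion₂_subset hs))⟩

theorem exists_dom_eq {V : Set A.base} (hV : IsClopen V) : ∃ s : ClopenSection A, s.dom = V := by
  obtain ⟨s, hs⟩ := exists_dom_eq_univ A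
  exact ⟨s.restrict V hV, by rw [dom_restrict, hs, Set.univ_inter]⟩

theorem inf_eq_left_iff {s t : ClopenSection A} : s ⊓ t = s ↔ s.dom ⊆ t.dom := by
  constructor
  · intro h
    rw [← h, dom_inf]
    exact Set.inter_subset_right
  · exact fun h => ext_mem fun e => ⟨fun he => he.1, fun he => ⟨he, h (proj_mem_dom he)⟩⟩

theorem mk_le_mk_iff {s t : ClopenSection A} : DQuot.mk s ≤ DQuot.mk t ↔ s.dom ⊆ t.dom := by
  rw [← inf_eq_left, ← DQuot.mk_inf, ← inf_eq_left_iff]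
  constructor
  · intro h
    have := (dRel_iff.1 (Quotient.exact (s := dSetoid _) h)).2
    rw [← this, SkewLattice.inf_assoc', SkewLattice.inf_assoc', SkewLattice.inf_idem']
  · exact fun h => by rw [h]

theorem dRel_iff_dom {s t : ClopenSection A} : SkewLattice.DRel s t ↔ s.dom = t.dom := by
  rw [dRel_iff, inf_eq_left_iff, inf_eq_left_iff, Set.Subset.antisymm_iff]

/-- The domain map embeds `S/𝒟` in the subsets of the base; complements exist because every clopen
set is the domain of a section. -/
theorem isBooleanLattice_dQuot (A : ESBSE.{u}) : IsBooleanLattice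
    (fun a b : DQuot (ClopenSection A) => a ⊓ b) (fun a b => a ⊔ b) := by
  have : Nonempty (DQuot (ClopenSection A)) := ⟨DQuot.mk 0⟩
  refine isBooleanLattice_of_injective
    (fun a : DQuot (ClopenSection A) => Quotient.lift dom (fun s t h => dRel_iff_dom.1 h) a)
    ?_ ?_ ?_ ?_
  · intro a b h
    obtain ⟨s, rfl⟩ := a.exists_rep
    obtain ⟨t, rfl⟩ := b.exists_rep
    exact DQuot.sound (dRel_iff_dom.2 h)
  · intro a b
    obtain ⟨s, rfl⟩ := a.exists_rep
    obtain ⟨t, rfl⟩ := b.exists_rep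
    exact dom_inf s t
  · intro a b
    obtain ⟨s, rfl⟩ := a.exists_rep
    obtain ⟨t, rfl⟩ := b.exists_rep
    exact dom_sup s t
  · intro a
    obtain ⟨s, rfl⟩ := a.exists_rep
    obtain ⟨t, ht⟩ := exists_dom_eq (A := A) s.isClopen_dom.compl
    exact ⟨DQuot.mk t, ht⟩

end ClopenSection

/-- The skew Boolean `∩`-algebra of sections over clopen sets. -/
def sectionAlgebra (A : ESBSE.{u}) : BLSBIA.{u} where
  carrier := ClopenSection A
  boolean := ClopenSection.isBooleanLattice_dQuot A

/-! ### The functor of sections -/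

namespace ESBSE.Cohom

variable {A B : ESBSE.{u}}

/-- The image of a set under a cohomomorphism. -/
def imageSet (c : Cohom B A) (s : Set B.total) : Set A.total :=
  {a | ∃ (x : A.base) (b : B.Stalk (c.f x)), b.1 ∈ s ∧ (c.k x b).1 = a}

/-- Injectivity on stalks enters here; it reduces preservation of each operation to a check stalk by
stalk. -/
theorem mem_imageSet (c : Cohom B A) {s : Set B.total} {x : A.base} {b : B.Stalk (c.f x)} :
    (c.k x b).1 ∈ c.imageSet s ↔ b.1 ∈ s := by
  constructor
  · rintro ⟨x', b', hb', h⟩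
    obtain rfl : x' = x := by
      have := congrArg A.proj h
      rwa [(c.k x' b').2, (c.k x b).2] at this
    rwa [← c.injective x' (Subtype.ext h)]
  · exact fun h => ⟨x, b, h, rfl⟩

theorem image_imageSet (c : Cohom B A) (s : Set B.total) :
    A.proj '' c.imageSet s = c.f ⁻¹' (B.proj '' s) := by
  ext x
  constructor
  · rintro ⟨_, ⟨x, b, hb, rfl⟩, rfl⟩
    exact ⟨b.1, hb, by rw [(c.k x b).2, b.2]⟩
  · rintro ⟨b, hb, h⟩
    exact ⟨_, ⟨x, ⟨b, h⟩, hb, rfl⟩, (c.k x ⟨b, h⟩).2⟩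

theorem injOn_imageSet (c : Cohom B A) {s : Set B.total} (hs : Set.InjOn B.proj s) :
    Set.InjOn A.proj (c.imageSet s) := by
  rintro _ ⟨x, b, hb, rfl⟩ _ ⟨x', b', hb', rfl⟩ h
  rw [(c.k x b).2, (c.k x' b').2] at h
  subst h
  obtain rfl : b = b' := Subtype.ext (hs hb hb' (b.2.trans b'.2.symm))
  rfl

/-- The image set is the range of `pushSection` applied to the section whose range is `s`. -/
theorem isOpen_imageSet (c : Cohom B A) (s : ClopenSection B) : IsOpen (c.imageSet s.carrier) := by
  obtain ⟨σ, hσ, h⟩ := exists_section_of_injOn B.isLocalHomeomorph s.isOpen s.injOn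
  have hU := s.isClopen_dom.isOpen
  have hr := isOpen_range_section A.isLocalHomeomorph (hU.preimage c.f.continuous)
    (c.isSection _ hU σ hσ)
  convert hr
  ext a
  constructor
  · rintro ⟨x, b, hb, rfl⟩
    refine ⟨⟨x, b.1, hb, b.2⟩, congrArg Subtype.val (congrArg (c.k x) (Subtype.ext ?_))⟩
    rw [h] at hb
    obtain ⟨y, hy⟩ := hb
    refine (congrArg σ (Subtype.ext ?_)).trans hy
    exact b.2.symm.trans (by rw [← hy, hσ.2])
  · rintro ⟨x, rfl⟩
    exact ⟨x.1, _, (Set.ext_iff.1 h _).2 ⟨⟨c.f x.1, x.2⟩, rfl⟩, rfl⟩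

/-- The image of a section under a cohomomorphism. -/
def imageSection (c : Cohom B A) (s : ClopenSection B) : ClopenSection A where
  carrier := c.imageSet s.carrier
  isOpen := c.isOpen_imageSet s
  injOn := c.injOn_imageSet s.injOn
  isClopen_dom := by
    rw [image_imageSet]
    exact s.isClopen_dom.preimage c.f.continuous

theorem mem_imageSection (c : Cohom B A) {s : ClopenSection B} {x : A.base}
    {b : B.Stalk (c.f x)} : (c.k x b).1 ∈ (c.imageSection s).carrier ↔ b.1 ∈ s.carrier :=
  c.mem_imageSet

theorem dom_imageSection (c : Cohom B A) (s : ClopenSection B) :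
    (c.imageSection s).dom = c.f ⁻¹' s.dom := c.image_imageSet _

theorem proj_mem_dom_imageSection (c : Cohom B A) {s : ClopenSection B} {x : A.base}
    {b : B.Stalk (c.f x)} : A.proj (c.k x b).1 ∈ (c.imageSection s).dom ↔
      B.proj b.1 ∈ s.dom := by
  rw [dom_imageSection, (c.k x b).2, b.2, Set.mem_preimage]

/-- Sets of elements in the image of a cohomomorphism are compared by their preimages. -/
theorem imageSection_eq (c : Cohom B A) {s : ClopenSection B} {t : ClopenSection A}
    (h₁ : ∀ a ∈ t.carrier, a ∈ c.imageSet Set.univ)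
    (h₂ : ∀ x (b : B.Stalk (c.f x)), b.1 ∈ s.carrier ↔ (c.k x b).1 ∈ t.carrier) :
    c.imageSection s = t := by
  refine ClopenSection.ext_mem fun a => ⟨?_, fun ha => ?_⟩
  · rintro ⟨x, b, hb, rfl⟩
    exact (h₂ x b).1 hb
  · obtain ⟨x, b, -, rfl⟩ := h₁ a ha
    exact c.mem_imageSection.2 ((h₂ x b).2 ha)

theorem imageSection_subset (c : Cohom B A) {s : ClopenSection B} :
    (c.imageSection s).carrier ⊆ c.imageSet Set.univ := by
  rintro _ ⟨x, b, -, rfl⟩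
  exact ⟨x, b, trivial, rfl⟩

/-- The homomorphism between algebras of sections induced by a cohomomorphism. -/
def toCapHom (c : Cohom B A) : CapHom (ClopenSection B) (ClopenSection A) where
  toFun := c.imageSection
  map_inf s t := c.imageSection_eq (fun a ha => c.imageSection_subset ha.1) fun x b => by
    simp only [ClopenSection.mem_inf, mem_imageSection, proj_mem_dom_imageSection]
  map_sup s t := c.imageSection_eq
    (fun a ha => ha.elim (c.imageSection_subset ·) (c.imageSection_subset ·.1)) fun x b => by
    simp only [ClopenSection.mem_sup, mem_imageSection, proj_mem_dom_imageSection]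
  map_sdiff s t := c.imageSection_eq (fun a ha => c.imageSection_subset ha.1) fun x b => by
    simp only [ClopenSection.mem_sdiff, mem_imageSection, proj_mem_dom_imageSection]
  map_zero := c.imageSection_eq (fun a ha => ha.elim) fun x b => Iff.rfl
  map_cap s t := c.imageSection_eq (fun a ha => c.imageSection_subset ha.1) fun x b => by
    simp only [ClopenSection.mem_cap, mem_imageSection]

theorem isProper_toCapHom (c : Cohom B A) : c.toCapHom.IsProper := by
  intro a
  obtain ⟨t, rfl⟩ := a.exists_rep
  obtain ⟨s, hs⟩ := ClopenSection.exists_dom_eq_univ B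
  refine ⟨DQuot.mk s, ClopenSection.mk_le_mk_iff.2 ?_⟩
  exact (Set.subset_univ _).trans_eq ((c.dom_imageSection s).trans (by simp [hs])).symm

end ESBSE.Cohom

/-- The functor that sends an étale space to its algebra of sections over clopen sets. -/
def sectionFunctor : ESBSE.{u} ⥤ BLSBIA.{u} where
  obj := sectionAlgebra
  map c := ⟨ESBSE.Cohom.toCapHom c, ESBSE.Cohom.isProper_toCapHom c⟩
  map_id A := Subtype.ext (CapHom.ext fun s =>
    ESBSE.Cohom.imageSection_eq (ESBSE.Cohom.id A) (fun a _ => ⟨A.proj a, ⟨a, rfl⟩, trivial, rfl⟩)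
      fun _ _ => Iff.rfl)
  map_comp {C B A} c d := Subtype.ext (CapHom.ext fun s =>
    ESBSE.Cohom.imageSection_eq (ESBSE.Cohom.comp c d) (by
      rintro _ ⟨x, b', ⟨y, b, hb, hk⟩, rfl⟩
      -- `c.k y b` and `b'` are the same point of `B`, so they lie over the same base point.
      obtain rfl : y = d.f x := (c.k y b).2.symm.trans ((congrArg B.proj hk).trans b'.2)
      exact ⟨x, b, trivial, congrArg (fun e => (d.k x e).1) (Subtype.ext hk)⟩)
      fun x b => by
        refine Iff.trans ?_ (ESBSE.Cohom.mem_imageSection d).symm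
        exact (ESBSE.Cohom.mem_imageSection c).symm)

/-! ### Faithfulness -/

theorem BooleanSpace.eq_of_forall_isClopen {X : Type u} [TopologicalSpace X] [BooleanSpace X]
    {x y : X} (h : ∀ V : Set X, IsClopen V → x ∈ V → y ∈ V) : x = y := by
  by_contra hne
  obtain ⟨V, hV, hx, hVy⟩ := BooleanSpace.isTopologicalBasis_clopen.exists_subset_of_mem_open
    (show x ∈ ({y}ᶜ : Set X) from hne) isOpen_compl_singleton
  exact hVy (h V hV hx) rfl

/-- Domains of images determine `f`; a section through `b` determines the value at `b`, the only
point of its image over `x`. -/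
theorem ESBSE.Cohom.eq_of_imageSection_eq {A B : ESBSE.{u}} {c d : Cohom B A}
    (h : ∀ s, c.imageSection s = d.imageSection s) : c = d := by
  have hf : c.f = d.f := ContinuousMap.ext fun x =>
    BooleanSpace.eq_of_forall_isClopen fun V hV hx => by
      obtain ⟨s, rfl⟩ := ClopenSection.exists_dom_eq hV
      have : x ∈ c.f ⁻¹' s.dom := hx
      rwa [← dom_imageSection, h, dom_imageSection] at this
  -- The base maps must be identified before the stalk maps have the same type.
  obtain ⟨f, k, hk, hki⟩ := c
  obtain ⟨f', k', hk', hki'⟩ := d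
  obtain rfl : f = f' := hf
  obtain rfl : k = k' := by
    funext x b
    obtain ⟨s, hs⟩ := ClopenSection.exists_mem_carrier b.1
    have h₁ := (mem_imageSection ⟨f, k, hk, hki⟩).2 hs
    have h₂ := (mem_imageSection ⟨f, k', hk', hki'⟩).2 hs
    rw [h] at h₁
    exact Subtype.ext ((ClopenSection.injOn _) h₁ h₂ ((k x b).2.trans (k' x b).2.symm))
  rfl

instance : sectionFunctor.{u}.Faithful where
  map_injective h := ESBSE.Cohom.eq_of_imageSection_eq fun s =>
    congrFun (congrArg CapHom.toFun (congrArg Subtype.val h)) s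

/-! ### Fullness -/

section Full

open ClopenSection

variable {A B : ESBSE.{u}}

theorem exists_dom_toFun_eq_univ {h : CapHom (ClopenSection B) (ClopenSection A)}
    (hp : h.IsProper) : ∃ s, (h.toFun s).dom = Set.univ := by
  obtain ⟨t, ht⟩ := exists_dom_eq_univ A
  obtain ⟨b, hb⟩ := hp (DQuot.mk t)
  obtain ⟨s, rfl⟩ := b.exists_rep
  exact ⟨s, Set.univ_subset_iff.1 (ht ▸ mk_le_mk_iff.1 hb)⟩

theorem eq_zero_of_dom_eq_empty {s : ClopenSection A} (hs : s.dom = ∅) : s = 0 :=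
  ext_mem fun e => ⟨fun he => by simpa [hs] using proj_mem_dom he, fun he => he.elim⟩

/-- The point of the base at which all sections with value at `x` are defined. -/
theorem exists_base_point {h : CapHom (ClopenSection B) (ClopenSection A)}
    (hp : h.IsProper) (x : A.base) : ∃ y : B.base, ∀ s, y ∈ s.dom ↔ x ∈ (h.toFun s).dom := by
  obtain ⟨s₀, hs₀⟩ := exists_dom_toFun_eq_univ hp
  have : Nonempty {s // x ∈ (h.toFun s).dom} := ⟨⟨s₀, hs₀ ▸ trivial⟩⟩
  -- These domains are directed under `⊓`, and none is empty since `h` preserves zero.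
  obtain ⟨y, hy⟩ := IsCompact.nonempty_iInter_of_directed_nonempty_isCompact_isClosed
    (fun s : {s // x ∈ (h.toFun s).dom} => s.1.dom)
    (fun s t => ⟨⟨s.1 ⊓ t.1, by rw [h.map_inf, dom_inf]; exact Set.mem_inter s.2 t.2⟩,
      (dom_inf s.1 t.1).trans_subset Set.inter_subset_left,
      (dom_inf s.1 t.1).trans_subset Set.inter_subset_right⟩)
    (fun s => by
      by_contra hne
      have := s.2
      rw [eq_zero_of_dom_eq_empty (Set.not_nonempty_iff_eq_empty.1 hne), h.map_zero,
        dom_zero] at this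
      exact this)
    (fun s => s.1.isClopen_dom.isClosed.isCompact) (fun s => s.1.isClopen_dom.isClosed)
  rw [Set.mem_iInter] at hy
  refine ⟨y, fun s => ⟨fun hs => ?_, fun hs => hy ⟨s, hs⟩⟩⟩
  by_contra hx
  -- If `x` is outside the domain of `h s`, then `s₀ \ s` belongs to the family, which keeps `y` out
  -- of the domain of `s`.
  have := hy ⟨s₀ \ s, by rw [h.map_sdiff, dom_sdiff]; exact ⟨hs₀ ▸ trivial, hx⟩⟩
  rw [dom_sdiff] at this
  exact this.2 hs

variable {h : CapHom (ClopenSection B) (ClopenSection A)}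

/-- The point is the value at `x` of `h s₀` for some `s₀` through `b`. Another `s` passes through
`b` exactly when `y` is in the domain of `cap s₀ s`, a condition that `h` transports. -/
theorem exists_stalk_point {x : A.base} {y : B.base}
    (hxy : ∀ s, y ∈ s.dom ↔ x ∈ (h.toFun s).dom) (b : B.Stalk y) :
    ∃ a : A.Stalk x, ∀ s, b.1 ∈ s.carrier ↔ a.1 ∈ (h.toFun s).carrier := by
  obtain ⟨s₀, hs₀⟩ := exists_mem_carrier b.1
  obtain ⟨a, ha, rfl⟩ := (hxy s₀).1 (b.2 ▸ proj_mem_dom hs₀)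
  refine ⟨⟨a, rfl⟩, fun s => ⟨fun hs => ?_, fun hs => ?_⟩⟩
  · obtain ⟨a', ha', hp⟩ := (hxy (SkewBooleanCapAlgebra.cap s₀ s)).1
      (b.2 ▸ proj_mem_dom (mem_cap.2 ⟨hs₀, hs⟩))
    rw [h.map_cap, mem_cap] at ha'
    exact (h.toFun s₀).injOn ha'.1 ha hp ▸ ha'.2
  · have : A.proj a ∈ (h.toFun (SkewBooleanCapAlgebra.cap s₀ s)).dom := by
      rw [h.map_cap]
      exact proj_mem_dom (mem_cap.2 ⟨ha, hs⟩)
    obtain ⟨b', hb', hp⟩ := (hxy _).2 this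
    exact s₀.injOn hb'.1 hs₀ (hp.trans b.2.symm) ▸ hb'.2

theorem exists_cohom (hp : h.IsProper) : ∃ c : ESBSE.Cohom B A, ∀ s,
    c.imageSection s = h.toFun s := by
  choose f hf using exists_base_point hp
  choose k hk using fun x => exists_stalk_point (hf x)
  have hfc : Continuous f := by
    refine BooleanSpace.isTopologicalBasis_clopen.continuous_iff.2 fun V hV => ?_
    obtain ⟨s, rfl⟩ := exists_dom_eq hV
    have : f ⁻¹' s.dom = (h.toFun s).dom := Set.ext fun x => hf x s
    rw [this]
    exact (h.toFun s).isClopen_dom.isOpen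
  refine ⟨⟨⟨f, hfc⟩, k, fun U hU σ hσ => ⟨?_, fun x => (k x.1 _).2⟩, ?_⟩, ?_⟩
  -- Where `σ ∘ f` lies in a section `s` through its value at `x`, the pushed section coincides with
  -- `h s`, which is continuous.
  · refine continuous_iff_continuousAt.2 fun x O hO => ?_
    obtain ⟨O, hOO, hO, hxO⟩ := mem_nhds_iff.1 hO
    obtain ⟨s, hs⟩ := exists_mem_carrier (σ ⟨f x.1, x.2⟩)
    have h₁ : IsOpen (A.proj '' (O ∩ (h.toFun s).carrier)) :=
      A.isLocalHomeomorph.isOpenMap _ (hO.inter (h.toFun s).isOpen)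
    have hg : Continuous fun x : f ⁻¹' U => σ ⟨f x.1, x.2⟩ :=
      hσ.1.comp ((hfc.comp continuous_subtype_val).subtype_mk _)
    have h₂ := (h₁.preimage (continuous_subtype_val (p := (· ∈ f ⁻¹' U)))).inter
      (s.isOpen.preimage hg)
    refine Filter.mem_map.2 (Filter.mem_of_superset (h₂.mem_nhds ⟨⟨_, ⟨hxO, (hk _ _ s).1 hs⟩, (k x.1 _).2⟩, hs⟩) ?_)
    rintro x' ⟨⟨a, ⟨haO, has⟩, hax⟩, hx'⟩
    have : a = ESBSE.pushSection f k U σ hσ x' :=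
      (h.toFun s).injOn has ((hk _ _ s).1 hx') (hax.trans (k x'.1 _).2.symm)
    rw [this] at haO
    exact hOO haO
  -- `k` preserves and reflects membership in sections, and a section meets a stalk in at most one
  -- point.
  · intro x b b' hb
    obtain ⟨s, hs⟩ := exists_mem_carrier b.1
    have hs' := (hk x b s).1 hs
    rw [hb] at hs'
    exact Subtype.ext (s.injOn hs ((hk x b' s).2 hs') (b.2.trans b'.2.symm))
  · refine fun s => ESBSE.Cohom.imageSection_eq _ (fun a ha => ?_) fun x b => hk x b s
    obtain ⟨b, hb, hbx⟩ := (hf (A.proj a) s).2 (proj_mem_dom ha)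
    refine ⟨A.proj a, ⟨b, hbx⟩, trivial, ?_⟩
    exact (h.toFun s).injOn ((hk _ _ s).1 hb) ha (k _ _).2

end Full

instance : sectionFunctor.{u}.Full where
  map_surjective g := by
    obtain ⟨c, hc⟩ := exists_cohom g.2
    exact ⟨c, Subtype.ext (CapHom.ext hc)⟩

open SkewLattice

/-! ### Elementary facts about left-handed skew Boolean algebras -/

section LeftHanded

variable {S : Type u} [SkewLattice S] [IsLeftHanded S]

theorem inf_le_left_of_leftHanded (x y : S) : x ⊓ y ≤ x :=
  ⟨IsLeftHanded.inf_inf x y, by rw [← inf_assoc', inf_idem']⟩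

theorem le_sup_right_of_leftHanded (x y : S) : y ≤ x ⊔ y :=
  ⟨inf_eq_left_iff_sup_eq.2 (by rw [← sup_assoc', IsLeftHanded.sup_sup]),
    sup_inf_absorb_right y x⟩

end LeftHanded

section SkewBoolean

variable {S : Type u} [SkewBooleanAlgebra S]

open SkewBooleanAlgebra

theorem inf_comm_of_le {a x y : S} (hx : x ≤ a) (hy : y ≤ a) : x ⊓ y = y ⊓ x := by
  obtain ⟨b, hb, -⟩ := SkewBooleanAlgebra.boolean a
  have h : principalInf a ⟨x, hx⟩ ⟨y, hy⟩ = principalInf a ⟨y, hy⟩ ⟨x, hx⟩ := by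
    rw [← hb, ← hb]
    exact @inf_comm _ b.toSemilatticeInf _ _
  exact congrArg Subtype.val h

variable [IsLeftHanded S]

theorem inf_le_of_commute {x y : S} (h : x ⊓ y = y ⊓ x) : x ⊓ y ≤ y :=
  h ▸ inf_le_left_of_leftHanded y x

theorem inf_sdiff_eq_zero (a b : S) : (a ⊓ b) ⊓ (a \ b) = 0 := by
  rw [← inf_sdiff' a b, IsLeftHanded.inf_inf]

theorem sup_sdiff_eq (a b : S) : (a ⊓ b) ⊔ (a \ b) = a := by
  conv_rhs => rw [← sup_sdiff' a b, IsLeftHanded.inf_inf]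

theorem sdiff_inf_eq_zero (a b : S) : (a \ b) ⊓ b = 0 := by
  calc (a \ b) ⊓ b = ((a \ b) ⊓ a) ⊓ b := by rw [(sdiff_le' a b).1]
    _ = (a \ b) ⊓ (a ⊓ b) := inf_assoc' _ _ _
    _ = (a ⊓ b) ⊓ (a \ b) :=
      inf_comm_of_le (sdiff_le' a b) (inf_le_left_of_leftHanded a b)
    _ = 0 := inf_sdiff_eq_zero a b

/-- `a \ b` and `b` meet in zero in either order, so by symmetry their joins commute and `a ⊔ b`
absorbs `a \ b` on both sides. -/
theorem sdiff_le_sup (a b : S) : a \ b ≤ a ⊔ b := by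
  have h₁ : b ⊓ (a \ b) = 0 := by
    rw [← IsLeftHanded.inf_inf, inf_assoc', sdiff_inf_eq_zero, inf_zero]
  have h₂ : (a \ b) ⊔ b = b ⊔ (a \ b) :=
    (symmetric _ _).2 ((sdiff_inf_eq_zero a b).trans h₁.symm)
  constructor
  · rw [inf_eq_left_iff_sup_eq, ← sup_assoc', inf_eq_left_iff_sup_eq.1 (sdiff_le' a b).1]
  · rw [inf_eq_right_iff_sup_eq, sup_assoc', ← h₂, ← sup_assoc',
      inf_eq_right_iff_sup_eq.1 (sdiff_le' a b).2]

end SkewBoolean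

/-! ### Prime characters -/

section Character

variable {S : Type u} [SkewBooleanCapAlgebra S]

open SkewBooleanAlgebra SkewBooleanCapAlgebra

variable (S) in
/-- The two-valued homomorphisms on `S` that are one at the elements above all others modulo
`𝒟`. They correspond to the prime filters of `S/𝒟`. -/
def characters : Set (S → Bool) :=
  {φ | φ 0 = false ∧ (∀ t, (∀ s, s ⊓ t = s) → φ t = true) ∧
    (∀ a b, φ (a ⊓ b) = (φ a && φ b)) ∧ ∀ a b, φ (a ⊔ b) = (φ a || φ b)}

/-- Each condition equates continuous functions on the product, so the spectrum is compact by
Tychonoff. -/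
theorem isClosed_characters : IsClosed (characters S) := by
  have hev (a : S) : Continuous fun φ : S → Bool => φ a := continuous_apply a
  have h2 {g : Bool → Bool → Bool} (a b : S) : Continuous fun φ : S → Bool => g (φ a) (φ b) :=
    (continuous_of_discreteTopology (f := fun p : Bool × Bool => g p.1 p.2)).comp
      ((hev a).prodMk (hev b))
  simp only [characters, Set.ofPred_and, Set.ofPred_forall]
  refine (isClosed_eq (hev 0) continuous_const).inter (.inter ?_ (.inter ?_ ?_))
  · exact isClosed_iInter fun t => isClosed_iInter fun _ => isClosed_eq (hev t) continuous_const
  · exact isClosed_iInter fun a => isClosed_iInter fun b => isClosed_eq (hev _) (h2 a b)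
  · exact isClosed_iInter fun a => isClosed_iInter fun b => isClosed_eq (hev _) (h2 a b)

variable (S) in
/-- The spectrum of `S/𝒟`, regarded as a space of two-valued functions on `S`. -/
abbrev Character : Type u := characters S

instance : BooleanSpace (Character S) where
  toCompactSpace := isCompact_iff_compactSpace.1 isClosed_characters.isCompact
  toT2Space := inferInstance
  isTopologicalBasis_clopen :=
    have : CompactSpace (Character S) :=
      isCompact_iff_compactSpace.1 isClosed_characters.isCompact
    isTopologicalBasis_isClopen

namespace Character

variable (φ : Character S)

theorem map_zero : φ.1 0 = false := φ.2.1

theorem map_inf {a b : S} : φ.1 (a ⊓ b) = true ↔ φ.1 a = true ∧ φ.1 b = true := by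
  rw [φ.2.2.2.1, Bool.and_eq_true]

theorem map_sup {a b : S} : φ.1 (a ⊔ b) = true ↔ φ.1 a = true ∨ φ.1 b = true := by
  rw [φ.2.2.2.2, Bool.or_eq_true]

theorem map_mono {a b : S} (h : a ≤ b) (ha : φ.1 a = true) : φ.1 b = true := by
  rw [← h.1, map_inf] at ha
  exact ha.2

/-- Equality of germs: `a` and `b` agree at `φ` when some common lower bound is true at `φ`. -/
theorem map_cap {a b : S} : φ.1 (cap a b) = true ↔ ∃ m, m ≤ a ∧ m ≤ b ∧ φ.1 m = true := by
  constructor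
  · exact fun h => ⟨_, (cap_isGLB a b).1 (by simp), (cap_isGLB a b).1 (by simp), h⟩
  · rintro ⟨m, ha, hb, h⟩
    refine φ.map_mono ((cap_isGLB a b).2 ?_) h
    rintro x (rfl | rfl)
    exacts [ha, hb]

variable [IsLeftHanded S]

theorem map_sdiff {a b : S} : φ.1 (a \ b) = true ↔ φ.1 a = true ∧ ¬φ.1 b = true := by
  have h₁ : φ.1 ((a ⊓ b) ⊔ (a \ b)) = true ↔ φ.1 a = true := by rw [sup_sdiff_eq]
  have h₂ : ¬φ.1 ((a ⊓ b) ⊓ (a \ b)) = true := by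
    rw [inf_sdiff_eq_zero, map_zero]
    exact Bool.false_ne_true
  rw [map_sup, map_inf] at h₁
  rw [map_inf, map_inf] at h₂
  tauto

variable {φ}

/-- A basic open set prescribes finitely many values. Starting from `t`, a prescribed `true` is
imposed by a meet and a prescribed `false` by a difference. -/
theorem exists_of_isOpen {t : S} (ht : ∀ s, s ⊓ t = s) {O : Set (Character S)} (hO : IsOpen O)
    (h : φ ∈ O) : ∃ c : S, φ.1 c = true ∧ ∀ ψ : Character S, ψ.1 c = true → ψ ∈ O := by
  classical
  obtain ⟨O', hO', rfl⟩ := isOpen_induced_iff.1 hO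
  obtain ⟨I, v, hv, hI⟩ := isOpen_pi_iff.1 hO' φ.1 h
  suffices H : ∀ I : Finset S, ∃ c : S, φ.1 c = true ∧ ∀ ψ : Character S, ψ.1 c = true →
      ∀ i ∈ I, ψ.1 i = φ.1 i by
    obtain ⟨c, hc, hψ⟩ := H I
    exact ⟨c, hc, fun ψ hc' => hI fun i hi => (hψ ψ hc' i hi).symm ▸ (hv i hi).2⟩
  intro I
  induction I using Finset.induction_on with
  | empty => exact ⟨t, φ.2.2.1 t ht, by simp⟩
  | insert a I _ ih =>
    obtain ⟨c, hc, hψ⟩ := ih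
    cases ha : φ.1 a with
    | true =>
      refine ⟨c ⊓ a, φ.map_inf.2 ⟨hc, ha⟩, fun ψ h i hi => ?_⟩
      rw [ψ.map_inf] at h
      rcases Finset.mem_insert.1 hi with rfl | hi
      exacts [h.2.trans ha.symm, hψ ψ h.1 i hi]
    | false =>
      refine ⟨c \ a, φ.map_sdiff.2 ⟨hc, by simp [ha]⟩, fun ψ h i hi => ?_⟩
      rw [ψ.map_sdiff] at h
      rcases Finset.mem_insert.1 hi with rfl | hi
      exacts [(Bool.eq_false_of_not_eq_true h.2).trans ha.symm, hψ ψ h.1 i hi]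

end Character

/-- A prime ideal avoiding `d` exists, and `φ` is the indicator of its complement. -/
theorem exists_bool_hom {L : Type*} [DistribLattice L] [BoundedOrder L] {d : L} (hd : d ≠ ⊥) :
    ∃ φ : L → Bool, φ ⊥ = false ∧ φ ⊤ = true ∧ (∀ a b, φ (a ⊓ b) = (φ a && φ b)) ∧
      (∀ a b, φ (a ⊔ b) = (φ a || φ b)) ∧ φ d = true := by
  classical
  obtain ⟨J, hJ, -, hd⟩ := DistribLattice.prime_ideal_of_disjoint_filter_ideal
    (F := Order.PFilter.principal d) (I := Order.Ideal.principal (⊥ : L)) (by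
      refine Set.disjoint_left.2 fun x hx hx' => hd ?_
      have h₁ : d ≤ x := Order.PFilter.mem_principal.1 hx
      have h₂ : x ≤ ⊥ := Order.Ideal.mem_principal.1 hx'
      exact le_bot_iff.1 (h₁.trans h₂))
  have hinf : ∀ a b, a ⊓ b ∈ J ↔ a ∈ J ∨ b ∈ J := fun a b =>
    ⟨hJ.mem_or_mem, fun h => h.elim (J.lower inf_le_left) (J.lower inf_le_right)⟩
  have hdJ : d ∉ J := Set.disjoint_left.1 hd (Order.PFilter.mem_principal.2 le_rfl)
  refine ⟨fun a => decide (a ∉ J), ?_, ?_, ?_, ?_, ?_⟩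
  · simp
  · exact decide_eq_true fun h => hdJ (J.lower le_top h)
  · intro a b
    simp [hinf, Bool.decide_and]
  · intro a b
    simp [Order.Ideal.sup_mem_iff]
  · exact decide_eq_true hdJ

theorem IsBooleanLattice.exists_top_bot {L : Type u} {meet join : L → L → L}
    (h : IsBooleanLattice meet join) : ∃ top bot : L, (∀ x, meet x top = x) ∧
      (∀ x, meet top x = x) ∧ (∀ x, meet x bot = bot) ∧ ∀ d ≠ bot, ∃ φ : L → Bool,
        φ bot = false ∧ φ top = true ∧ (∀ a b, φ (meet a b) = (φ a && φ b)) ∧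
        (∀ a b, φ (join a b) = (φ a || φ b)) ∧ φ d = true := by
  obtain ⟨b, hb, hb'⟩ := h
  obtain rfl : b.inf = meet := funext fun x => funext (hb x)
  obtain rfl : b.sup = join := funext fun x => funext (hb' x)
  exact ⟨⊤, ⊥, fun x => inf_top_eq x, fun x => top_inf_eq x, fun x => inf_bot_eq x,
    fun d hd => exists_bool_hom hd⟩

section Boolean

variable [IsLeftHanded S]

theorem exists_inf_eq_self
    (hS : IsBooleanLattice (fun a b : DQuot S => a ⊓ b) (fun a b => a ⊔ b)) :
    ∃ t : S, ∀ s, s ⊓ t = s := by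
  obtain ⟨t, -, h, -⟩ := hS.exists_top_bot
  obtain ⟨t, rfl⟩ := t.exists_rep
  refine ⟨t, fun s => ?_⟩
  have := (dRel_iff.1 (Quotient.exact (s := dSetoid S) (h (DQuot.mk s)))).2
  rw [← this, inf_assoc', inf_assoc', inf_idem']

theorem exists_character
    (hS : IsBooleanLattice (fun a b : DQuot S => a ⊓ b) (fun a b => a ⊔ b))
    {d : S} (hd : d ≠ 0) : ∃ φ : Character S, φ.1 d = true := by
  obtain ⟨t, z, -, ht, hz, h⟩ := hS.exists_top_bot
  have h0 : DQuot.mk 0 = z := by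
    rw [← hz (DQuot.mk 0)]
    obtain ⟨z, rfl⟩ := z.exists_rep
    exact (congrArg DQuot.mk (zero_inf z)).symm
  have hdz : DQuot.mk d ≠ z := fun h => hd (by
    have := (dRel_iff.1 (Quotient.exact (s := dSetoid S) (h.trans h0.symm))).1
    rw [← this, inf_zero])
  obtain ⟨φ, h₁, h₂, h₃, h₄, h₅⟩ := h _ hdz
  refine ⟨⟨fun a => φ (DQuot.mk a), ?_, fun t' ht' => ?_,
    fun x y => h₃ (DQuot.mk x) (DQuot.mk y),
    fun x y => h₄ (DQuot.mk x) (DQuot.mk y)⟩, h₅⟩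
  · exact (congrArg φ h0).trans h₁
  · refine (congrArg φ ?_).trans h₂
    rw [← ht (DQuot.mk t')]
    obtain ⟨s, rfl⟩ := t.exists_rep
    exact congrArg DQuot.mk (ht' s)

/-- Every character vanishes on `a \ c`, so this element is zero and `a` reduces to `a ⊓ c = c`. -/
theorem eq_of_forall_character
    (hS : IsBooleanLattice (fun a b : DQuot S => a ⊓ b) (fun a b => a ⊔ b))
    {c a : S} (hc : c ≤ a)
    (h : ∀ φ : Character S, φ.1 a = true → φ.1 c = true) : c = a := by
  have h0 : a \ c = 0 := by
    by_contra hne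
    obtain ⟨φ, hφ⟩ := exists_character hS hne
    rw [φ.map_sdiff] at hφ
    exact hφ.2 (h φ hφ.1)
  have := sup_sdiff_eq a c
  rw [h0, hc.2] at this
  rw [← this]
  exact (inf_eq_right_iff_sup_eq.1 (inf_zero c)).symm

end Boolean

end Character

/-! ### The space of germs -/

section Germ

variable {S : Type u} [SkewBooleanCapAlgebra S]

open SkewBooleanAlgebra SkewBooleanCapAlgebra

variable (S) in
/-- The germ of `c : S` at a character `φ` with `φ c = true` is represented by `φ` and by the
function that tells which elements of `S` have the same germ as `c`. -/
def germs : Set (Character S × (S → Bool)) :=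
  {p | ∃ c, p.1.1 c = true ∧ ∀ b, p.2 b = p.1.1 (cap c b)}

variable (S) in
/-- The space of germs. -/
abbrev Germ : Type u := germs S

namespace Germ

/-- The projection of the space of germs to the spectrum. -/
def proj (e : Germ S) : Character S := e.1.1

/-- The germ of `c` at `φ`. -/
def mk (φ : Character S) (c : S) (hc : φ.1 c = true) : Germ S :=
  ⟨(φ, fun b => φ.1 (cap c b)), c, hc, fun _ => rfl⟩

/-- The set of all germs of `a`. -/
def support (a : S) : Set (Germ S) := {e | e.1.2 a = true}

theorem mk_mem_support (φ : Character S) (c : S) (hc : φ.1 c = true) : mk φ c hc ∈ support c :=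
  φ.map_cap.2 ⟨c, le_refl c, le_refl c, hc⟩

theorem mem_support_iff (e : Germ S) : ∃ c, ∀ b, e ∈ support b ↔
    ∃ m, m ≤ c ∧ m ≤ b ∧ e.proj.1 m = true := by
  obtain ⟨⟨φ, F⟩, c, hc, hF⟩ := e
  refine ⟨c, fun b => ?_⟩
  rw [← Character.map_cap]
  exact (hF b).congr_left

variable {e : Germ S} {a b : S}

theorem exists_mem_support (e : Germ S) : ∃ c, e ∈ support c := by
  obtain ⟨⟨φ, F⟩, c, hc, hF⟩ := e
  exact ⟨c, (hF c).trans (φ.map_cap.2 ⟨c, le_refl c, le_refl c, hc⟩)⟩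

theorem proj_of_mem_support (h : e ∈ support a) : e.proj.1 a = true := by
  obtain ⟨c, hc⟩ := e.mem_support_iff
  obtain ⟨m, -, hm, h⟩ := (hc a).1 h
  exact e.proj.map_mono hm h

theorem support_mono (h : a ≤ b) : support a ⊆ support b := by
  intro e he
  obtain ⟨c, hc⟩ := e.mem_support_iff
  obtain ⟨m, hmc, hm, hφ⟩ := (hc a).1 he
  exact (hc b).2 ⟨m, hmc, hm.trans h, hφ⟩

theorem notMem_support_zero : e ∉ support 0 := fun h => by
  have := proj_of_mem_support h
  rw [e.proj.map_zero] at this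
  exact Bool.false_ne_true this

theorem continuous_proj : Continuous (proj : Germ S → Character S) :=
  continuous_fst.comp continuous_subtype_val

theorem isOpen_support (a : S) : IsOpen (support a) :=
  (isOpen_discrete {true}).preimage
    (f := fun e : Germ S => e.1.2 a)
    ((continuous_apply a).comp (continuous_snd.comp continuous_subtype_val))

theorem isClopen_eval (a : S) : IsClopen {φ : Character S | φ.1 a = true} :=
  (isClopen_discrete {true}).preimage (f := fun φ : Character S => φ.1 a)
    ((continuous_apply a).comp continuous_subtype_val)

theorem image_proj_support (a : S) : proj '' support a = {φ | φ.1 a = true} := by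
  ext φ
  constructor
  · rintro ⟨e, he, rfl⟩
    exact proj_of_mem_support he
  · exact fun h => ⟨mk φ a h, mk_mem_support φ a h, rfl⟩

variable [IsLeftHanded S]

/-- If `m` witnesses that `e` is a germ of `b`, then `m ⊓ a` does so for `a`: below `b` the two
elements commute, so their meet lies under both. -/
theorem mem_support_of_le (h : e ∈ support b) (hab : a ≤ b) (ha : e.proj.1 a = true) :
    e ∈ support a := by
  obtain ⟨c, hc⟩ := e.mem_support_iff
  obtain ⟨m, hmc, hm, hφ⟩ := (hc b).1 h
  exact (hc a).2 ⟨m ⊓ a, (inf_le_left_of_leftHanded m a).trans hmc,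
    inf_le_of_commute (inf_comm_of_le hm hab), e.proj.map_inf.2 ⟨hφ, ha⟩⟩

theorem mem_support_inf : e ∈ support (a ⊓ b) ↔ e ∈ support a ∧ e.proj.1 b = true := by
  have hle := inf_le_left_of_leftHanded a b
  constructor
  · exact fun h => ⟨support_mono hle h, (e.proj.map_inf.1 (proj_of_mem_support h)).2⟩
  · exact fun h => mem_support_of_le h.1 hle (e.proj.map_inf.2 ⟨proj_of_mem_support h.1, h.2⟩)

theorem mem_support_sdiff : e ∈ support (a \ b) ↔ e ∈ support a ∧ ¬e.proj.1 b = true := by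
  have hle := sdiff_le' a b
  constructor
  · exact fun h => ⟨support_mono hle h, (e.proj.map_sdiff.1 (proj_of_mem_support h)).2⟩
  · exact fun h => mem_support_of_le h.1 hle (e.proj.map_sdiff.2 ⟨proj_of_mem_support h.1, h.2⟩)

theorem mem_support_sup : e ∈ support (a ⊔ b) ↔
    e ∈ support b ∨ e ∈ support a ∧ ¬e.proj.1 b = true := by
  constructor
  · intro h
    by_cases hb : e.proj.1 b = true
    · exact Or.inl (mem_support_of_le h (le_sup_right_of_leftHanded a b) hb)
    · have ha := (e.proj.map_sup.1 (proj_of_mem_support h)).resolve_right hb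
      exact Or.inr ⟨support_mono (sdiff_le' a b)
        (mem_support_of_le h (sdiff_le_sup a b) (e.proj.map_sdiff.2 ⟨ha, hb⟩)), hb⟩
  · rintro (h | h)
    · exact support_mono (le_sup_right_of_leftHanded a b) h
    · exact support_mono (sdiff_le_sup a b) (mem_support_sdiff.2 h)

theorem mem_support_cap : e ∈ support (cap a b) ↔ e ∈ support a ∧ e ∈ support b := by
  have ha : cap a b ≤ a := (cap_isGLB a b).1 (by simp)
  have hb : cap a b ≤ b := (cap_isGLB a b).1 (by simp)
  refine ⟨fun h => ⟨support_mono ha h, support_mono hb h⟩, fun h => ?_⟩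
  refine mem_support_of_le h.1 ha (e.proj.map_cap.2 ?_)
  obtain ⟨c, hc⟩ := e.mem_support_iff
  -- Both witnesses lie below the representative `c`, hence commute, and their meet lies below `a`
  -- and `b`.
  obtain ⟨m, hmc, hm, hφ⟩ := (hc a).1 h.1
  obtain ⟨n, hnc, hn, hφ'⟩ := (hc b).1 h.2
  exact ⟨m ⊓ n, (inf_le_left_of_leftHanded m n).trans hm,
    (inf_le_of_commute (inf_comm_of_le hmc hnc)).trans hn, e.proj.map_inf.2 ⟨hφ, hφ'⟩⟩

/-- A germ of `a` is thus determined by its projection, which yields injectivity on `support a`. -/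
theorem mem_support_iff_proj (h : e ∈ support a) : e ∈ support b ↔ e.proj.1 (cap a b) = true :=
  ⟨fun hb => proj_of_mem_support (mem_support_cap.2 ⟨h, hb⟩), fun hb =>
    (mem_support_cap.1 (mem_support_of_le h ((cap_isGLB a b).1 (by simp)) hb)).2⟩

theorem injOn_proj_support (a : S) : Set.InjOn proj (support a) := by
  intro e he e' he' h
  refine Subtype.ext (Prod.ext h (funext fun b => Bool.eq_iff_iff.2 ?_))
  exact (mem_support_iff_proj he).trans (h ▸ (mem_support_iff_proj he').symm)

/-- The projection maps the set of germs of an element homeomorphically onto its image. -/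
def supportHomeomorph (a : S) : support a ≃ₜ {φ : Character S | φ.1 a = true} where
  toFun e := ⟨e.1.proj, proj_of_mem_support e.2⟩
  invFun φ := ⟨mk φ.1 a φ.2, mk_mem_support _ _ _⟩
  left_inv e := Subtype.ext (injOn_proj_support a
    (mk_mem_support e.1.proj a (proj_of_mem_support e.2)) e.2 rfl)
  right_inv _ := rfl
  continuous_toFun := (continuous_proj.comp continuous_subtype_val).subtype_mk _
  continuous_invFun := by
    refine Continuous.subtype_mk (Continuous.subtype_mk (continuous_subtype_val.prodMk ?_) _) _
    exact continuous_pi fun b =>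
      (continuous_apply (cap a b)).comp (continuous_subtype_val.comp continuous_subtype_val)

theorem isLocalHomeomorph_proj : IsLocalHomeomorph (proj : Germ S → Character S) := by
  refine isLocalHomeomorph_iff_isOpenEmbedding_restrict.2 fun e => ?_
  obtain ⟨a, ha⟩ := e.exists_mem_support
  refine ⟨support a, (isOpen_support a).mem_nhds ha, ?_⟩
  have := (isClopen_eval a).isOpen.isOpenEmbedding_subtypeVal.comp
    (supportHomeomorph a).isOpenEmbedding
  exact this

end Germ

end Germ

/-- Sections over clopen sets are compact, and so is their intersection in a Hausdorff space; its
image is closed by compactness and open because `π` is open. -/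
theorem exists_inter_mem_sectionSets {E X : Type u} [TopologicalSpace E] [TopologicalSpace X]
    [T2Space E] [CompactSpace X] [T2Space X] {π : E → X} (hπ : IsLocalHomeomorph π) {U V : Set X}
    (hU : IsClopen U) (hV : IsClopen V) {A B : Set E} (hA : A ∈ sectionSets π U)
    (hB : B ∈ sectionSets π V) : ∃ W, IsClopen W ∧ A ∩ B ∈ sectionSets π W := by
  have hc {U : Set X} {A : Set E} (hU : IsClopen U) (hA : A ∈ sectionSets π U) :
      IsCompact A := by
    obtain ⟨s, hs, rfl⟩ := hA
    have : CompactSpace U := isCompact_iff_compactSpace.1 hU.isClosed.isCompact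
    exact isCompact_range hs.1
  have hA' := (mem_sectionSets_iff hπ hU.isOpen).1 hA
  have hB' := (mem_sectionSets_iff hπ hV.isOpen).1 hB
  have hO : IsOpen (π '' (A ∩ B)) := hπ.isOpenMap _ (hA'.1.inter hB'.1)
  exact ⟨π '' (A ∩ B), ⟨(((hc hU hA).inter (hc hV hB)).image hπ.continuous).isClosed, hO⟩,
    (mem_sectionSets_iff hπ hO).2 ⟨hA'.1.inter hB'.1, hA'.2.1.mono Set.inter_subset_left, rfl⟩⟩

/-! ### Essential surjectivity -/

/-- The étale space of germs over the spectrum of `S/𝒟`. -/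
def spectrum (S : BLSBIA.{u}) : ESBSE.{u} where
  base := Character S.carrier
  total := Germ S.carrier
  proj := Germ.proj
  isLocalHomeomorph := Germ.isLocalHomeomorph_proj
  surjective φ := by
    obtain ⟨t, ht⟩ := exists_inf_eq_self S.boolean
    exact ⟨Germ.mk φ t (φ.2.2.1 t ht), rfl⟩
  clopen_equalizers _ _ hU hV _ hA _ hB :=
    -- The germ space is Hausdorff as a subspace of a product of Hausdorff spaces.
    exists_inter_mem_sectionSets Germ.isLocalHomeomorph_proj hU hV hA hB

section Spectrum

variable (S : BLSBIA.{u})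

/-- The section of germs of an element. -/
def germSection (a : S.carrier) : ClopenSection (spectrum S) where
  carrier := Germ.support a
  isOpen := Germ.isOpen_support a
  injOn := Germ.injOn_proj_support a
  isClopen_dom := (Germ.image_proj_support a).symm ▸ Germ.isClopen_eval a

theorem mem_dom_germSection {a : S.carrier} {φ : Character S.carrier} :
    φ ∈ (germSection S a).dom ↔ φ.1 a = true :=
  Set.ext_iff.1 (Germ.image_proj_support a) φ

/-- An element of `S` regarded as a section of germs. -/
def germHom : CapHom S.carrier (ClopenSection (spectrum S)) where
  toFun := germSection S
  map_inf _ _ := ClopenSection.ext_mem fun _ => Germ.mem_support_inf.trans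
    (and_congr_right' (mem_dom_germSection S).symm)
  map_sup _ _ := ClopenSection.ext_mem fun _ => Germ.mem_support_sup.trans
    (or_congr_right (and_congr_right' (not_congr (mem_dom_germSection S).symm)))
  map_sdiff _ _ := ClopenSection.ext_mem fun _ => Germ.mem_support_sdiff.trans
    (and_congr_right' (not_congr (mem_dom_germSection S).symm))
  map_zero := ClopenSection.ext_mem fun e => iff_of_false Germ.notMem_support_zero
    (ClopenSection.notMem_zero e)
  map_cap _ _ := ClopenSection.ext_mem fun _ => Germ.mem_support_cap

open SkewBooleanCapAlgebra in
theorem injective_germHom : Function.Injective (germHom S).toFun := by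
  -- If `a` and `b` have the same germs, every character true at `a` is true at `cap a b`, which
  -- forces equality.
  have key : ∀ a b : S.carrier, germSection S a = germSection S b → cap a b = a := fun a b h =>
    eq_of_forall_character S.boolean ((cap_isGLB a b).1 (by simp)) fun φ hφ => by
      have ha := Germ.mk_mem_support φ a hφ
      have hb : Germ.mk φ a hφ ∈ (germSection S b).carrier := h ▸ ha
      exact Germ.proj_of_mem_support (Germ.mem_support_cap.2 ⟨ha, hb⟩)
  intro a b h
  have hab : a ≤ b := by
    rw [← key a b h]
    exact (cap_isGLB a b).1 (by simp)
  have hba : b ≤ a := by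
    rw [← key b a h.symm]
    exact (cap_isGLB b a).1 (by simp)
  exact le_antisymm hab hba

variable {S}

/-- Any `c` with germ `e` agrees with `s` over a neighbourhood of the projection of `e`; meeting `c`
with a `d` whose characters lie there confines it to `s`. -/
theorem exists_support_subset (s : ClopenSection (spectrum S)) {e : Germ S.carrier}
    (he : e ∈ s.carrier) : ∃ a, e ∈ Germ.support a ∧ Germ.support a ⊆ s.carrier := by
  obtain ⟨t, ht⟩ := exists_inf_eq_self S.boolean
  obtain ⟨c, hc⟩ := e.exists_mem_support
  have hO : IsOpen (Germ.proj '' (s.carrier ∩ Germ.support c)) :=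
    Germ.isLocalHomeomorph_proj.isOpenMap _ (s.isOpen.inter (Germ.isOpen_support c))
  obtain ⟨d, hd, hdO⟩ := Character.exists_of_isOpen ht hO ⟨e, ⟨he, hc⟩, rfl⟩
  refine ⟨c ⊓ d, Germ.mem_support_inf.2 ⟨hc, hd⟩, fun e' he' => ?_⟩
  rw [Germ.mem_support_inf] at he'
  obtain ⟨e'', ⟨hs, hc''⟩, h⟩ := hdO _ he'.2
  rwa [← Germ.injOn_proj_support c hc'' he'.1 h]

/-- Finitely many supports inside `s` cover its domain; their join stays inside `s` and is defined
on that whole domain, so it fills `s`. -/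
theorem surjective_germHom : Function.Surjective (germHom S).toFun := by
  classical
  intro s
  obtain ⟨I, hI⟩ := s.isClopen_dom.isClosed.isCompact.elim_finite_subcover
    (fun a : {a : S.carrier // Germ.support a ⊆ s.carrier} => (germSection S a.1).dom)
    (fun a => (germSection S a.1).isClopen_dom.isOpen) (by
      rintro _ ⟨e, he, rfl⟩
      obtain ⟨a, ha, has⟩ := exists_support_subset s he
      exact Set.mem_iUnion.2 ⟨⟨a, has⟩, ClopenSection.proj_mem_dom (s := germSection S a) ha⟩)
  have key : ∀ I : Finset {a : S.carrier // Germ.support a ⊆ s.carrier},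
      ∃ a : S.carrier, Germ.support a ⊆ s.carrier ∧
        ∀ i ∈ I, ∀ φ : Character S.carrier, φ.1 i.1 = true → φ.1 a = true := by
    intro I
    induction I using Finset.induction_on with
    | empty => exact ⟨0, fun e he => (Germ.notMem_support_zero he).elim, by simp⟩
    | insert i I _ ih =>
      obtain ⟨a, ha, h⟩ := ih
      refine ⟨i.1 ⊔ a, fun e he => ?_, fun j hj φ hφ => φ.map_sup.2 ?_⟩
      · exact (Germ.mem_support_sup.1 he).elim (ha ·) (i.2 ·.1)
      · rcases Finset.mem_insert.1 hj with rfl | hj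
        exacts [Or.inl hφ, Or.inr (h j hj φ hφ)]
  obtain ⟨a, ha, h⟩ := key I
  refine ⟨a, ClopenSection.ext_mem fun e => ⟨(ha ·), fun he => ?_⟩⟩
  obtain ⟨i, hi, hφ⟩ := Set.mem_iUnion₂.1 (hI (ClopenSection.proj_mem_dom he))
  have hφ' := h i hi _ ((mem_dom_germSection S).1 hφ)
  have hm := Germ.mk_mem_support _ a hφ'
  rwa [← s.injOn (ha hm) he rfl]

end Spectrum

/-- A bijective homomorphism is an isomorphism. -/
noncomputable def isoOfBijective {S T : BLSBIA.{u}} (f : CapHom S.carrier T.carrier)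
    (hf : Function.Bijective f.toFun) : S ≅ T :=
  let e := Equiv.ofBijective f.toFun hf
  have he (x : T.carrier) : f.toFun (e.symm x) = x := e.apply_symm_apply x
  let g : CapHom T.carrier S.carrier :=
    { toFun := e.symm
      map_inf := fun x y => hf.1 (by rw [f.map_inf, he, he, he])
      map_sup := fun x y => hf.1 (by rw [f.map_sup, he, he, he])
      map_sdiff := fun x y => hf.1 (by rw [f.map_sdiff, he, he, he])
      map_zero := hf.1 (by rw [f.map_zero, he])
      map_cap := fun x y => hf.1 (by rw [f.map_cap, he, he, he]) }
  have hfp : f.IsProper := fun c => by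
    obtain ⟨x, rfl⟩ := c.exists_rep
    exact ⟨DQuot.mk (e.symm x), by rw [CapHom.induced_mk, he]⟩
  have hgp : g.IsProper := fun c => by
    obtain ⟨x, rfl⟩ := c.exists_rep
    exact ⟨DQuot.mk (f.toFun x), (congrArg DQuot.mk (e.symm_apply_apply x)).ge⟩
  { hom := ⟨f, hfp⟩
    inv := ⟨g, hgp⟩
    hom_inv_id := Subtype.ext (CapHom.ext e.symm_apply_apply)
    inv_hom_id := Subtype.ext (CapHom.ext he) }

instance : sectionFunctor.{u}.EssSurj where
  mem_essImage S := ⟨spectrum S, ⟨(isoOfBijective (T := sectionAlgebra (spectrum S)) (germHom S)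
    ⟨injective_germHom S, surjective_germHom⟩).symm⟩⟩

instance : sectionFunctor.{u}.IsEquivalence where

end SkewStone

theorem corollary1p4 : Nonempty (SkewStone.ESBSE.{u} ≌ SkewStone.BLSBIA.{u}) :=
  ⟨SkewStone.sectionFunctor.asEquivalence⟩
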